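/- All graphs are finite, simple and have at least one vertex. A (vertex) weighted graph $\Omega$ is a simple graph, its base, with a positive integer weight at each vertex; a simple graph is a weighted graph with all weights $1$. A matching of $\Omega$ is a family of edges, not necessarily different, in which each vertex appears no more times than its weight, and the matching number $\nu(\Omega)$ is the largest possible number of edges of a matching. For a vertex $i$, let $N_\Omega(i)$ be the set of vertices adjacent to $i$ and $\deg_\Omega(i)$ the sum of the weights of the vertices in $N_\Omega(i)$; for a set $N$ of vertices, $\Omega-N$ is the induced weighted graph obtained by deleting $N$. The weighted graph $\Omega$ is $t$-saturating if $\nu(\Omega)<t$ and $\nu(\Omega-N_\Omega(i))\ge t-\deg_\Omega(i)$ for every vertex $i$. We say that $\Omega$ is spanned by a weighted graph $\Theta$ if $\Omega$ has the same vertices with the same weights as $\Theta$ and contains all edges of $\Theta$ (and possibly more edges). Types are understood up to isomorphism; a disjoint union has no edges between its parts; weights that are not mentioned are $1$. **Theorem.** A weighted graph $\Omega$ is $4$-saturating if and only if it belongs to one of the types in the following two lists. *Simple types (all weights are $1$):* 1. $\Omega$ is a $K_5$; 2. $\Omega$ is spanned by a cone on $C_5$; 3. $\Omega$ is spanned by the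 union of $4$ triangles $\{a,c,d\},\{b,c,d\},\{a,e,f\},\{b,e,f\}$ on six vertices $a,\dots,f$; 4. $\Omega$ is spanned by a triangular prism; 5. $\Omega$ is a disjoint union of a triangle and a graph spanned by a $C_5$; 6. $\Omega$ is a disjoint union of a triangle and a graph spanned by two triangles meeting at a vertex; 7. $\Omega$ is a disjoint union of a triangle and a $K_4$; 8. $\Omega$ is spanned by a $C_7$; 9. $\Omega$ is spanned by a union of a triangle and a pentagon meeting at a vertex; 10. $\Omega$ is spanned by a union of two pentagons sharing a path of length $2$ (and nothing else); 11. $\Omega$ is spanned by a union of three triangles meeting at a vertex; 12. $\Omega$ is spanned by two disjoint triangles connected by a path of length $2$; 13. $\Omega$ is a disjoint union of three triangles. *Types with some weight at least $2$:* 1. $\Omega$ is a triangle with weights $(2,2,2)$, $(3,2,2)$ or $(3,3,1)$; 2. $\Omega$ is spanned by a union of a triangle $\{a,b,c\}$ and an edge $\{a,d\}$, where the weights of $(a,b,c,d)$ are $(3,2,1,1)$, $(3,1,1,2)$ or $(2,2,2,1)$; 3. $\Omega$ is spanned by a union of a triangle $\{a,b,c\}$ and two edges, which are $\{a,d\},\{d,e\}$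 with weight $2$ at $a$ and $d$; or $\{a,d\},\{b,e\}$ with weight $2$ at $a$ and $b$; or $\{a,d\},\{a,e\}$ with weight $3$ at $a$; 4. $\Omega$ is spanned by a union of two triangles, which share an edge whose two vertices have weight $2$; or which meet at a vertex, where either this vertex has weight $2$, or this vertex and one further vertex have weight $2$, or the two other vertices of one of the triangles have weight $2$; 5. $\Omega$ is spanned by a union of two triangles and an edge, which is one of the following: two triangles and an edge, all meeting at one common vertex, which has weight $2$; two triangles meeting at a vertex and an edge $\{v,w\}$, where $v$ is another vertex of one of the triangles and has weight $2$ and $w$ lies on no triangle; two disjoint triangles connected by an edge, one of whose two vertices has weight $2$; 6. $\Omega$ is spanned by a pentagon with weights $(2,2,1,1,1)$ in cyclic order; 7. $\Omega$ is spanned by a union of a pentagon and an edge meeting at a vertex of weight $2$; 8. $\Omega$ is spanned by a union of a rectangle ($C_4$) and a triangle meeting at a vertex of weight $2$; 9. $\Omega$ is a disjoint union of a simple triangle and a triangle with weights $(2,2,1)$; 10. $\Omega$ is a disjoint union of a simple triangle and a weighted graph spanned by a triangle and an edge meeting at a vertex of weight $2$. -/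

import Mathlib

/-- A (vertex) weighted graph on the vertex set `V`: a simple graph (the base) whose vertices are
assigned positive integer weights. -/
structure WeightedGraph (V : Type*) where
  /-- the base of the weighted graph -/
  base : SimpleGraph V
  /-- the weight of a vertex -/
  weight : V → ℕ
  weight_pos : ∀ v, 0 < weight v

namespace WeightedGraph

variable {V W : Type*}

/-! ### Matchings, degrees, and saturating weighted graphs -/

open Classical in
/-- A matching is a family of edges, not necessarily different, in which each vertex appears no
more times than its weight. -/
def IsMatching (Ω : WeightedGraph V) (M : Multiset (Sym2 V)) : Prop :=
  (∀ e ∈ M, e ∈ Ω.base.edgeSet) ∧ ∀ v, (M.filter fun e => v ∈ e).card ≤ Ω.weight v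

/-- The matching number `ν(Ω)`: the largest possible number of edges of a matching. -/
noncomputable def matchingNumber (Ω : WeightedGraph V) : ℕ :=
  sSup {k | ∃ M, Ω.IsMatching M ∧ M.card = k}

/-- On a finite vertex set the supremum in the definition of `ν(Ω)` is a maximum. -/
theorem isGreatest_matchingNumber [Finite V] (Ω : WeightedGraph V) :
    IsGreatest {k | ∃ M, Ω.IsMatching M ∧ M.card = k} Ω.matchingNumber := by
  classical
  have := Fintype.ofFinite V
  refine ⟨Nat.sSup_mem ⟨0, 0, ⟨by simp, by simp⟩, rfl⟩ ⟨∑ v, Ω.weight v, ?_⟩,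
    fun k hk => le_csSup ⟨∑ v, Ω.weight v, ?_⟩ hk⟩
  all_goals
    rintro _ ⟨M, hM, rfl⟩
    refine le_trans ?_ (Finset.sum_le_sum fun v _ => hM.2 v)
    clear hM
    induction M using Multiset.induction_on with
    | empty => simp
    | cons e M ih =>
      have h1 : 1 ≤ ∑ v, if v ∈ e then 1 else 0 := by
        induction e using Sym2.ind with
        | _ a b =>
          refine le_trans ?_ (Finset.single_le_sum (fun _ _ => Nat.zero_le _)
            (Finset.mem_univ a))
          simp
      have h2 : ∀ v, ((e ::ₘ M).filter fun e => v ∈ e).card =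
          (if v ∈ e then 1 else 0) + (M.filter fun e => v ∈ e).card := by
        intro v
        by_cases hv : v ∈ e <;> simp [hv, add_comm]
      simp only [h2, Finset.sum_add_distrib, Multiset.card_cons]
      omega

open Classical in
/-- `deg_Ω(i)`: the sum of the weights of the vertices adjacent to `i`. -/
noncomputable def degree [Fintype V] (Ω : WeightedGraph V) (i : V) : ℕ :=
  ∑ j with Ω.base.Adj i j, Ω.weight j

/-- `Ω - N`: the induced weighted subgraph obtained by deleting all vertices in `N`. -/
def deleteVerts (Ω : WeightedGraph V) (N : Set V) : WeightedGraph ↥(Nᶜ) where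
  base := Ω.base.induce Nᶜ
  weight v := Ω.weight v
  weight_pos v := Ω.weight_pos v

/-- `Ω` is `t`-saturating if `ν(Ω) < t` and `ν(Ω - N(i)) ≥ t - deg(i)` for all vertices `i`. -/
def IsSaturating [Fintype V] (Ω : WeightedGraph V) (t : ℕ) : Prop :=
  Ω.matchingNumber < t ∧
    ∀ i, ((Ω.deleteVerts (Ω.base.neighborSet i)).matchingNumber : ℤ) ≥ (t : ℤ) - Ω.degree i

/-! ### Isomorphism, spanning, disjoint unions, and concrete weighted graphs -/

/-- `Ω` is, up to renaming the vertices, the weighted graph `Θ`. -/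
def IsIso (Ω : WeightedGraph V) (Θ : WeightedGraph W) : Prop :=
  ∃ f : W ≃ V, (∀ a, Ω.weight (f a) = Θ.weight a) ∧
    ∀ a b, Ω.base.Adj (f a) (f b) ↔ Θ.base.Adj a b

/-- `Ω` is spanned by `Θ`: after renaming the vertices, `Ω` has the same vertices with the same
weights as `Θ`, and every edge of `Θ` is an edge of `Ω` (which may have further edges). -/
def IsSpannedBy (Ω : WeightedGraph V) (Θ : WeightedGraph W) : Prop :=
  ∃ f : W ≃ V, (∀ a, Ω.weight (f a) = Θ.weight a) ∧
    ∀ a b, Θ.base.Adj a b → Ω.base.Adj (f a) (f b)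

/-- The disjoint union of two weighted graphs, with no edges between them. -/
def disjointUnion (Ω : WeightedGraph V) (Θ : WeightedGraph W) : WeightedGraph (V ⊕ W) where
  base := Ω.base.sum Θ.base
  weight := Sum.elim Ω.weight Θ.weight
  weight_pos := by rintro (v | w); exacts [Ω.weight_pos v, Θ.weight_pos w]

/-- A simple graph as a weighted graph: all weights are one. -/
def ofSimple (G : SimpleGraph V) : WeightedGraph V := ⟨G, fun _ => 1, fun _ => one_pos⟩

/-- The simple graph on `0, …, n - 1` with the listed edges. -/
def edges (n : ℕ) (L : List (Fin n × Fin n)) : SimpleGraph (Fin n) :=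
  SimpleGraph.fromRel fun a b => (a, b) ∈ L

/-- The triangle with all weights one. -/
def triangle : WeightedGraph (Fin 3) := ofSimple ⊤

/-- The pentagon with all weights one. -/
def pentagon : WeightedGraph (Fin 5) := ofSimple (SimpleGraph.cycleGraph 5)

/-- Two triangles `0 1 2` and `0 3 4` meeting at the vertex `0`. -/
def bowtie : SimpleGraph (Fin 5) := edges 5 [(0, 1), (0, 2), (1, 2), (0, 3), (0, 4), (3, 4)]

/-- The triangle `0 1 2` and the edge `0 3` meeting at the vertex `0`. -/
def paw : SimpleGraph (Fin 4) := edges 4 [(0, 1), (0, 2), (1, 2), (0, 3)]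

/-! ### The two lists of types -/

/-- The types all of whose vertices have weight one. -/
inductive IsSimpleType (Ω : WeightedGraph V) : Prop
  /-- a complete graph on five vertices -/
  | completeFive (h : Ω.IsIso (ofSimple (⊤ : SimpleGraph (Fin 5))))
  /-- spanned by a cone on a pentagon -/
  | conePentagon (h : Ω.IsSpannedBy (ofSimple (edges 6
      [(0, 1), (1, 2), (2, 3), (3, 4), (4, 0), (5, 0), (5, 1), (5, 2), (5, 3), (5, 4)])))
  /-- spanned by the union of the four triangles `0 2 3`, `1 2 3`, `0 4 5`, `1 4 5` -/
  | fourTriangles (h : Ω.IsSpannedBy (ofSimple (edges 6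
      [(0, 2), (0, 3), (1, 2), (1, 3), (2, 3), (0, 4), (0, 5), (1, 4), (1, 5), (4, 5)])))
  /-- spanned by a triangular prism -/
  | prism (h : Ω.IsSpannedBy (ofSimple (edges 6
      [(0, 1), (1, 2), (0, 2), (3, 4), (4, 5), (3, 5), (0, 3), (1, 4), (2, 5)])))
  /-- a disjoint union of a triangle and a graph spanned by a pentagon -/
  | trianglePentagonDisjoint (Θ : WeightedGraph (Fin 5)) (hΘ : Θ.IsSpannedBy pentagon)
      (h : Ω.IsIso (triangle.disjointUnion Θ))
  /-- a disjoint union of a triangle and a graph spanned by two triangles meeting at a vertex -/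
  | triangleBowtieDisjoint (Θ : WeightedGraph (Fin 5)) (hΘ : Θ.IsSpannedBy (ofSimple bowtie))
      (h : Ω.IsIso (triangle.disjointUnion Θ))
  /-- a disjoint union of a triangle and a complete graph on four vertices -/
  | triangleCompleteFour
      (h : Ω.IsIso (triangle.disjointUnion (ofSimple (⊤ : SimpleGraph (Fin 4)))))
  /-- spanned by a cycle of length seven -/
  | heptagon (h : Ω.IsSpannedBy (ofSimple (SimpleGraph.cycleGraph 7)))
  /-- spanned by the union of a triangle and a pentagon meeting at a vertex -/
  | trianglePentagon (h : Ω.IsSpannedBy (ofSimple (edges 7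
      [(0, 1), (0, 2), (1, 2), (0, 3), (3, 4), (4, 5), (5, 6), (6, 0)])))
  /-- spanned by the union of the two pentagons `0 1 2 3 4` and `0 1 2 5 6`, which share the path
  `0 1 2` of length two -/
  | twoPentagons (h : Ω.IsSpannedBy (ofSimple (edges 7
      [(0, 1), (1, 2), (2, 3), (3, 4), (4, 0), (2, 5), (5, 6), (6, 0)])))
  /-- spanned by the union of three triangles meeting at a vertex -/
  | threeTriangles (h : Ω.IsSpannedBy (ofSimple (edges 7
      [(0, 1), (0, 2), (1, 2), (0, 3), (0, 4), (3, 4), (0, 5), (0, 6), (5, 6)])))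
  /-- spanned by two triangles connected by a path of length two -/
  | twoTrianglesPath (h : Ω.IsSpannedBy (ofSimple (edges 7
      [(0, 1), (0, 2), (1, 2), (2, 3), (3, 4), (4, 5), (4, 6), (5, 6)])))
  /-- a disjoint union of three triangles -/
  | threeTrianglesDisjoint
      (h : Ω.IsIso (triangle.disjointUnion (triangle.disjointUnion triangle)))

/-- The types with a vertex of weight at least two. The `i`-th entry of a weight vector is the
weight of the vertex `i`. -/
inductive IsNonsimpleType (Ω : WeightedGraph V) : Prop
  /-- a triangle with weights `(2,2,2)` -/
  | triangle222 (h : Ω.IsIso ⟨(⊤ : SimpleGraph (Fin 3)), ![2, 2, 2], by decide⟩)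
  /-- a triangle with weights `(3,2,2)` -/
  | triangle322 (h : Ω.IsIso ⟨(⊤ : SimpleGraph (Fin 3)), ![3, 2, 2], by decide⟩)
  /-- a triangle with weights `(3,3,1)` -/
  | triangle331 (h : Ω.IsIso ⟨(⊤ : SimpleGraph (Fin 3)), ![3, 3, 1], by decide⟩)
  /-- a triangle and an edge meeting at a vertex of weight three, with another vertex of the
  triangle of weight two -/
  | paw3211 (h : Ω.IsSpannedBy ⟨paw, ![3, 2, 1, 1], by decide⟩)
  /-- a triangle and an edge meeting at a vertex of weight three, with the other vertex of the edge
  of weight two -/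
  | paw3112 (h : Ω.IsSpannedBy ⟨paw, ![3, 1, 1, 2], by decide⟩)
  /-- a triangle with all weights two and an edge meeting at a vertex -/
  | paw2221 (h : Ω.IsSpannedBy ⟨paw, ![2, 2, 2, 1], by decide⟩)
  /-- a triangle `0 1 2` and the two edges `0 3`, `3 4`, with weight two at `0` and `3` -/
  | trianglePathTail (h : Ω.IsSpannedBy
      ⟨edges 5 [(0, 1), (0, 2), (1, 2), (0, 3), (3, 4)], ![2, 1, 1, 2, 1], by decide⟩)
  /-- a triangle `0 1 2` and the two edges `0 3`, `1 4`, with weight two at `0` and `1` -/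
  | triangleTwoTails (h : Ω.IsSpannedBy
      ⟨edges 5 [(0, 1), (0, 2), (1, 2), (0, 3), (1, 4)], ![2, 2, 1, 1, 1], by decide⟩)
  /-- a triangle `0 1 2` and the two edges `0 3`, `0 4`, with weight three at `0` -/
  | triangleDoubleTail (h : Ω.IsSpannedBy
      ⟨edges 5 [(0, 1), (0, 2), (1, 2), (0, 3), (0, 4)], ![3, 1, 1, 1, 1], by decide⟩)
  /-- two triangles sharing an edge whose two vertices have weight two -/
  | diamond (h : Ω.IsSpannedBy
      ⟨edges 4 [(0, 1), (0, 2), (1, 2), (0, 3), (1, 3)], ![2, 2, 1, 1], by decide⟩)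
  /-- two triangles meeting at a vertex of weight two -/
  | bowtie21111 (h : Ω.IsSpannedBy ⟨bowtie, ![2, 1, 1, 1, 1], by decide⟩)
  /-- two triangles meeting at a vertex of weight two, with one more vertex of weight two -/
  | bowtie22111 (h : Ω.IsSpannedBy ⟨bowtie, ![2, 2, 1, 1, 1], by decide⟩)
  /-- two triangles meeting at a vertex of weight one, where the other two vertices of one of the
  triangles have weight two -/
  | bowtie12211 (h : Ω.IsSpannedBy ⟨bowtie, ![1, 2, 2, 1, 1], by decide⟩)
  /-- two triangles and an edge meeting at a common vertex of weight two -/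
  | bowtieTailCenter (h : Ω.IsSpannedBy
      ⟨edges 6 [(0, 1), (0, 2), (1, 2), (0, 3), (0, 4), (3, 4), (0, 5)],
        ![2, 1, 1, 1, 1, 1], by decide⟩)
  /-- two triangles meeting at the vertex `0`, and an edge meeting one of them at another vertex
  `1`, which has weight two -/
  | bowtieTailLeaf (h : Ω.IsSpannedBy
      ⟨edges 6 [(0, 1), (0, 2), (1, 2), (0, 3), (0, 4), (3, 4), (1, 5)],
        ![1, 2, 1, 1, 1, 1], by decide⟩)
  /-- two disjoint triangles connected by an edge, one of whose vertices has weight two -/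
  | twoTrianglesEdge (h : Ω.IsSpannedBy
      ⟨edges 6 [(0, 1), (0, 2), (1, 2), (0, 3), (3, 4), (3, 5), (4, 5)],
        ![2, 1, 1, 1, 1, 1], by decide⟩)
  /-- a pentagon with weights `(2,2,1,1,1)`, in cyclic order -/
  | pentagon22111 (h : Ω.IsSpannedBy
      ⟨SimpleGraph.cycleGraph 5, ![2, 2, 1, 1, 1], by decide⟩)
  /-- a pentagon and an edge meeting at a vertex of weight two -/
  | pentagonTail (h : Ω.IsSpannedBy
      ⟨edges 6 [(0, 1), (1, 2), (2, 3), (3, 4), (4, 0), (0, 5)], ![2, 1, 1, 1, 1, 1], by decide⟩)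
  /-- a rectangle and a triangle meeting at a vertex of weight two -/
  | rectangleTriangle (h : Ω.IsSpannedBy
      ⟨edges 6 [(0, 1), (0, 2), (1, 2), (0, 3), (3, 4), (4, 5), (5, 0)],
        ![2, 1, 1, 1, 1, 1], by decide⟩)
  /-- a disjoint union of a triangle with all weights one and a triangle with weights `(2,2,1)` -/
  | triangleTriangle221 (h : Ω.IsIso
      (triangle.disjointUnion ⟨(⊤ : SimpleGraph (Fin 3)), ![2, 2, 1], by decide⟩))
  /-- a disjoint union of a triangle with all weights one and a weighted graph spanned by a triangle
  and an edge meeting at a vertex of weight two -/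
  | trianglePaw (Θ : WeightedGraph (Fin 4))
      (hΘ : Θ.IsSpannedBy ⟨paw, ![2, 1, 1, 1], by decide⟩)
      (h : Ω.IsIso (triangle.disjointUnion Θ))

end WeightedGraph

namespace WeightedGraph

open Finset

variable {V W : Type*}

/-! ### Matchings with respect to a weight function that may vanish -/

open Classical in
/-- The number of members of `M` that contain the vertex `v`. -/
noncomputable def edgeDeg (M : Multiset (Sym2 V)) (v : V) : ℕ := M.countP fun e => v ∈ e

/-- `M` is a family of edges of `G` in which each vertex `v` appears at most `w v` times. -/
def IsMat (G : SimpleGraph V) (w : V → ℕ) (M : Multiset (Sym2 V)) : Prop :=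
  (∀ e ∈ M, e ∈ G.edgeSet) ∧ ∀ v, edgeDeg M v ≤ w v

/-- There is a matching with `m` edges. -/
def HasM (G : SimpleGraph V) (w : V → ℕ) (m : ℕ) : Prop := ∃ M, IsMat G w M ∧ M.card = m

open Classical in
/-- The total weight of the neighbours of `v`. -/
noncomputable def wdeg [Fintype V] (G : SimpleGraph V) (w : V → ℕ) (v : V) : ℕ :=
  ∑ u with G.Adj v u, w u

open Classical in
/-- The weight function obtained by erasing the neighbours of `v`. -/
noncomputable def del (G : SimpleGraph V) (w : V → ℕ) (v : V) : V → ℕ :=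
  fun u => if G.Adj v u then 0 else w u

/-- The saturation property for weight functions that may vanish. -/
def Sat [Fintype V] (G : SimpleGraph V) (w : V → ℕ) (t : ℕ) : Prop :=
  ¬ HasM G w t ∧ ∀ v, 0 < w v → HasM G (del G w v) (t - wdeg G w v)

open Classical in
/-- The weight function `w` with the weight of `v` lowered by one. -/
noncomputable def lower (w : V → ℕ) (v : V) : V → ℕ := fun u => if u = v then w u - 1 else w u

@[simp] theorem edgeDeg_zero (v : V) : edgeDeg 0 v = 0 := by simp [edgeDeg]

open Classical in
theorem edgeDeg_cons (e : Sym2 V) (M : Multiset (Sym2 V)) (v : V) :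
    edgeDeg (e ::ₘ M) v = edgeDeg M v + if v ∈ e then 1 else 0 := by
  simp [edgeDeg, Multiset.countP_cons]

theorem edgeDeg_mono {M N : Multiset (Sym2 V)} (h : M ≤ N) (v : V) : edgeDeg M v ≤ edgeDeg N v := by
  classical exact Multiset.countP_le_of_le _ h

theorem exists_mem_of_edgeDeg_pos {M : Multiset (Sym2 V)} {v : V} (h : 0 < edgeDeg M v) :
    ∃ u, s(v, u) ∈ M := by
  classical
  obtain ⟨e, he, hv⟩ := Multiset.countP_pos.1 h
  obtain ⟨u, rfl⟩ := Sym2.mem_iff_exists.1 hv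
  exact ⟨u, he⟩

theorem edgeDeg_pos {M : Multiset (Sym2 V)} {v : V} {e : Sym2 V} (he : e ∈ M) (hv : v ∈ e) :
    0 < edgeDeg M v := by
  classical exact Multiset.countP_pos.2 ⟨e, he, hv⟩

theorem isMat_cons {G : SimpleGraph V} {w : V → ℕ} {M : Multiset (Sym2 V)} {a b : V} :
    IsMat G w (s(a, b) ::ₘ M) ↔
      G.Adj a b ∧ 0 < w a ∧ 0 < w b ∧ IsMat G (lower (lower w a) b) M := by
  classical
  constructor
  · rintro ⟨h1, h2⟩
    have hab : G.Adj a b := by simpa using h1 s(a, b) (Multiset.mem_cons_self _ _)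
    have hne := hab.ne
    refine ⟨hab, ?_, ?_, fun e he => h1 e (Multiset.mem_cons_of_mem he), fun v => ?_⟩
    · have := h2 a; simp [edgeDeg_cons] at this; omega
    · have := h2 b; simp [edgeDeg_cons] at this; omega
    · have := h2 v
      simp only [edgeDeg_cons, Sym2.mem_iff] at this
      unfold lower
      by_cases hva : v = a <;> by_cases hvb : v = b <;> simp_all <;> omega
  · rintro ⟨hab, ha, hb, h1, h2⟩
    have hne := hab.ne
    refine ⟨fun e he => ?_, fun v => ?_⟩
    · rcases Multiset.mem_cons.1 he with rfl | he
      · simpa using hab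
      · exact h1 e he
    · have := h2 v
      simp only [edgeDeg_cons, Sym2.mem_iff]
      unfold lower at this
      by_cases hva : v = a <;> by_cases hvb : v = b <;> simp_all <;> omega

theorem HasM.zero (G : SimpleGraph V) (w : V → ℕ) : HasM G w 0 := ⟨0, ⟨by simp, by simp⟩, rfl⟩

theorem hasM_succ {G : SimpleGraph V} {w : V → ℕ} {m : ℕ} :
    HasM G w (m + 1) ↔
      ∃ a b, G.Adj a b ∧ 0 < w a ∧ 0 < w b ∧ HasM G (lower (lower w a) b) m := by
  constructor
  · rintro ⟨M, hM, hc⟩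
    obtain ⟨e, he⟩ := Multiset.card_pos_iff_exists_mem.1 (show 0 < M.card by omega)
    obtain ⟨M, rfl⟩ := Multiset.exists_cons_of_mem he
    induction e using Sym2.ind with
    | _ a b =>
      obtain ⟨h1, h2, h3, h4⟩ := isMat_cons.1 hM
      exact ⟨a, b, h1, h2, h3, M, h4, by simpa using hc⟩
  · rintro ⟨a, b, h1, h2, h3, M, h4, rfl⟩
    exact ⟨s(a, b) ::ₘ M, isMat_cons.2 ⟨h1, h2, h3, h4⟩, by simp⟩

theorem IsMat.of_le {G : SimpleGraph V} {w : V → ℕ} {M N : Multiset (Sym2 V)} (hN : IsMat G w N)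
    (h : M ≤ N) : IsMat G w M :=
  ⟨fun e he => hN.1 e (Multiset.mem_of_le h he), fun v => (edgeDeg_mono h v).trans (hN.2 v)⟩

theorem HasM.anti {G : SimpleGraph V} {w : V → ℕ} {m n : ℕ} (h : HasM G w n) (hmn : m ≤ n) :
    HasM G w m := by
  obtain ⟨N, hN, rfl⟩ := h
  obtain ⟨M, hM⟩ := Multiset.card_pos_iff_exists_mem.1 (show 0 < (N.powersetCard m).card by
    simpa using Nat.choose_pos hmn)
  obtain ⟨hle, hc⟩ := Multiset.mem_powersetCard.1 hM
  exact ⟨M, hN.of_le hle, hc⟩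

theorem HasM.mono {G H : SimpleGraph V} {w x : V → ℕ} {m : ℕ} (h : HasM G w m) (hG : G ≤ H)
    (hw : ∀ v, w v ≤ x v) : HasM H x m := by
  obtain ⟨M, hM, rfl⟩ := h
  exact ⟨M, ⟨fun e he => SimpleGraph.edgeSet_mono hG (hM.1 e he), fun v => (hM.2 v).trans (hw v)⟩,
    rfl⟩

theorem lower_le (w : V → ℕ) (v u : V) : lower w v u ≤ w u := by
  unfold lower; split <;> omega

/-- If no member of `M` leaves the set `C` of vertices, then the vertices of `C` appear twice as
often in `M` as there are members of `M` inside `C`. -/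
theorem sum_edgeDeg_of_closed (C : Finset V) (M : Multiset (Sym2 V))
    [DecidablePred fun e : Sym2 V => ∃ x ∈ e, x ∈ C]
    (hM : ∀ a b, s(a, b) ∈ M → a ≠ b ∧ (a ∈ C ↔ b ∈ C)) :
    ∑ x ∈ C, edgeDeg M x = 2 * M.countP fun e => ∃ x ∈ e, x ∈ C := by
  classical
  induction M using Multiset.induction_on with
  | empty => simp
  | cons e M ih =>
    simp only [edgeDeg_cons, sum_add_distrib, Multiset.countP_cons]
    rw [ih fun a b h => hM a b (Multiset.mem_cons_of_mem h), mul_add]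
    congr 1
    induction e using Sym2.ind with
    | _ a b =>
      obtain ⟨hne, hC⟩ := hM a b (Multiset.mem_cons_self _ _)
      rw [← Finset.card_filter]
      by_cases ha : a ∈ C
      · have hb := hC.1 ha
        have : {x ∈ C | x ∈ s(a, b)} = {a, b} := by
          ext x; simp only [mem_filter, Sym2.mem_iff, mem_insert, mem_singleton]
          constructor
          · exact fun h => h.2
          · rintro (rfl | rfl) <;> simp [ha, hb]
        rw [this, card_pair hne]
        simp [ha]
      · have hb : b ∉ C := fun h => ha (hC.2 h)
        have : {x ∈ C | x ∈ s(a, b)} = ∅ := by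
          ext x; simp only [mem_filter, Sym2.mem_iff, notMem_empty, iff_false]
          rintro ⟨hx, rfl | rfl⟩ <;> contradiction
        rw [this]
        simp [ha, hb]

theorem sum_edgeDeg [Fintype V] {G : SimpleGraph V} {w : V → ℕ} {M : Multiset (Sym2 V)}
    (hM : IsMat G w M) : ∑ x, edgeDeg M x = 2 * M.card := by
  classical
  rw [sum_edgeDeg_of_closed univ M fun a b h => ⟨?_, by simp⟩]
  · congr 1
    rw [Multiset.countP_eq_card]
    intro e _
    induction e using Sym2.ind with
    | _ a b => exact ⟨a, by simp⟩
  · have : G.Adj a b := by simpa using hM.1 _ h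
    exact this.ne

theorem HasM.two_mul_le [Fintype V] {G : SimpleGraph V} {w : V → ℕ} {m : ℕ} (h : HasM G w m) :
    2 * m ≤ ∑ v, w v := by
  obtain ⟨M, hM, rfl⟩ := h
  rw [← sum_edgeDeg hM]
  exact sum_le_sum fun v _ => hM.2 v

/-! ### Transfer along embeddings -/

theorem hasM_comap {G : SimpleGraph V} {w : V → ℕ} (f : W ↪ V) (hw : ∀ v, v ∉ Set.range f → w v = 0)
    (m : ℕ) : HasM (G.comap f) (w ∘ f) m ↔ HasM G w m := by
  classical
  induction m generalizing w with
  | zero => simp [HasM.zero]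
  | succ m ih =>
    have key : ∀ a b, lower (lower w (f a)) (f b) ∘ f = lower (lower (w ∘ f) a) b := by
      intro a b; ext x; simp [lower, f.injective.eq_iff]
    have hz : ∀ a b, ∀ v, v ∉ Set.range f → lower (lower w (f a)) (f b) v = 0 := fun a b v hv =>
      Nat.le_zero.1 (((lower_le _ _ _).trans (lower_le _ _ _)).trans (hw v hv).le)
    rw [hasM_succ, hasM_succ]
    constructor
    · rintro ⟨a, b, h1, h2, h3, h4⟩
      exact ⟨f a, f b, h1, h2, h3, by rwa [← ih (hz a b), key]⟩
    · rintro ⟨a, b, h1, h2, h3, h4⟩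
      obtain ⟨a, rfl⟩ : a ∈ Set.range f := by by_contra h; rw [hw a h] at h2; omega
      obtain ⟨b, rfl⟩ : b ∈ Set.range f := by by_contra h; rw [hw b h] at h3; omega
      exact ⟨a, b, h1, h2, h3, by rwa [← key, ih (hz a b)]⟩

theorem wdeg_comap [Fintype V] [Fintype W] {G : SimpleGraph V} {w : V → ℕ} (f : W ↪ V)
    (hw : ∀ v, v ∉ Set.range f → w v = 0) (i : W) :
    wdeg (G.comap f) (w ∘ f) i = wdeg G w (f i) := by
  classical
  unfold wdeg
  simp only [SimpleGraph.comap_adj, Function.comp_apply, sum_filter]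
  rw [← sum_map univ f fun v => if G.Adj (f i) v then w v else 0]
  refine sum_subset (subset_univ _) fun v _ hv => ?_
  rw [hw v fun ⟨x, hx⟩ => hv (by simp [← hx])]
  simp

theorem del_comap {G : SimpleGraph V} {w : V → ℕ} (f : W ↪ V) (i : W) :
    del (G.comap f) (w ∘ f) i = del G w (f i) ∘ f := by
  ext x
  by_cases h : G.Adj (f i) (f x) <;> simp [del, h, SimpleGraph.comap_adj]

theorem sat_comap [Fintype V] [Fintype W] {G : SimpleGraph V} {w : V → ℕ} (f : W ↪ V)
    (hw : ∀ v, v ∉ Set.range f → w v = 0) (t : ℕ) :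
    Sat (G.comap f) (w ∘ f) t ↔ Sat G w t := by
  have hd : ∀ i, HasM (G.comap f) (del (G.comap f) (w ∘ f) i) (t - wdeg (G.comap f) (w ∘ f) i) ↔
      HasM G (del G w (f i)) (t - wdeg G w (f i)) := by
    intro i
    rw [wdeg_comap f hw, del_comap, hasM_comap f]
    intro v hv
    simp [del, hw v hv]
  unfold Sat
  rw [hasM_comap f hw]
  refine and_congr Iff.rfl ⟨fun h v hv => ?_, fun h i hi => (hd i).2 (h (f i) hi)⟩
  obtain ⟨i, rfl⟩ : v ∈ Set.range f := by by_contra h; rw [hw v h] at hv; omega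
  exact (hd i).1 (h i hv)

theorem hasM_iff_le_matchingNumber [Finite V] (Ω : WeightedGraph V) (m : ℕ) :
    HasM Ω.base Ω.weight m ↔ m ≤ Ω.matchingNumber := by
  have hset : ∀ k, HasM Ω.base Ω.weight k ↔ k ∈ {k | ∃ M, Ω.IsMatching M ∧ M.card = k} := by
    intro k
    simp only [HasM, IsMat, IsMatching, edgeDeg, Multiset.countP_eq_card_filter, Set.mem_ofPred_eq]
  exact ⟨fun h => Ω.isGreatest_matchingNumber.2 ((hset m).1 h),
    fun h => ((hset _).2 Ω.isGreatest_matchingNumber.1).anti h⟩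

theorem isSaturating_iff_sat [Fintype V] (Ω : WeightedGraph V) (t : ℕ) :
    Ω.IsSaturating t ↔ Sat Ω.base Ω.weight t := by
  classical
  unfold IsSaturating Sat
  rw [hasM_iff_le_matchingNumber, not_le]
  refine and_congr Iff.rfl (forall_congr' fun i => ?_)
  have h1 : HasM Ω.base (del Ω.base Ω.weight i) (t - wdeg Ω.base Ω.weight i) ↔
      t - wdeg Ω.base Ω.weight i ≤ (Ω.deleteVerts (Ω.base.neighborSet i)).matchingNumber := by
    rw [← hasM_iff_le_matchingNumber, ← hasM_comap (Function.Embedding.subtype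
      (· ∈ (Ω.base.neighborSet i)ᶜ))]
    · refine iff_of_eq ?_
      congr 1
      ext x
      have : ¬ Ω.base.Adj i x := x.2
      simp [del, deleteVerts, this]
    · intro v hv
      have hv' : Ω.base.Adj i v := by
        by_contra h
        exact hv ⟨⟨v, h⟩, rfl⟩
      simp [del, hv']
  have h2 : wdeg Ω.base Ω.weight i = Ω.degree i := rfl
  rw [h2] at h1
  simp only [Ω.weight_pos i, true_imp_iff, h2, h1]
  omega

/-! ### Degrees and essential vertices -/

theorem IsMat.cons {G : SimpleGraph V} {w : V → ℕ} {M : Multiset (Sym2 V)} {a b : V}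
    (hM : IsMat G w M) (hab : G.Adj a b) (ha : edgeDeg M a < w a) (hb : edgeDeg M b < w b) :
    IsMat G w (s(a, b) ::ₘ M) := by
  classical
  refine ⟨fun e he => ?_, fun v => ?_⟩
  · rcases Multiset.mem_cons.1 he with rfl | he
    · simpa using hab
    · exact hM.1 e he
  · have := hM.2 v
    rw [edgeDeg_cons]
    split_ifs with h
    · rcases Sym2.mem_iff.1 h with rfl | rfl <;> omega
    · omega

theorem IsMat.adj {G : SimpleGraph V} {w : V → ℕ} {M : Multiset (Sym2 V)} {a b : V}
    (hM : IsMat G w M) (h : s(a, b) ∈ M) : G.Adj a b ∧ 0 < w a ∧ 0 < w b :=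
  ⟨by simpa using hM.1 _ h, (edgeDeg_pos h (by simp)).trans_le (hM.2 a),
    (edgeDeg_pos h (by simp)).trans_le (hM.2 b)⟩

theorem edgeDeg_del_self {G : SimpleGraph V} {w : V → ℕ} {v : V} {M : Multiset (Sym2 V)}
    (hM : IsMat G (del G w v) M) : edgeDeg M v = 0 := by
  by_contra h
  obtain ⟨u, hu⟩ := exists_mem_of_edgeDeg_pos (Nat.pos_of_ne_zero h)
  obtain ⟨h1, -, h2⟩ := hM.adj hu
  simp [del, h1] at h2

theorem del_le (G : SimpleGraph V) (w : V → ℕ) (v u : V) : del G w v u ≤ w u := by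
  unfold del; split <;> omega

theorem HasM.succ_of_del {G : SimpleGraph V} {w : V → ℕ} {v u : V} {m : ℕ}
    (h : HasM G (del G w v) m) (hvu : G.Adj v u) (hv : 0 < w v) (hu : 0 < w u) :
    HasM G w (m + 1) := by
  obtain ⟨M, hM, rfl⟩ := h
  have hMv := edgeDeg_del_self hM
  have hMu : edgeDeg M u ≤ 0 := by simpa [del, hvu] using hM.2 u
  have hM' : IsMat G w M := ⟨hM.1, fun x => (hM.2 x).trans (del_le _ _ _ _)⟩
  exact ⟨_, hM'.cons hvu (by omega) (by omega), by simp⟩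

theorem Sat.two_le_wdeg [Fintype V] {G : SimpleGraph V} {w : V → ℕ} {t : ℕ} (h : Sat G w t) {v : V}
    (hv : 0 < w v) : 2 ≤ wdeg G w v := by
  classical
  by_contra hlt
  obtain ⟨h1, h2⟩ := h
  have h3 := h2 v hv
  rcases Nat.eq_zero_or_pos (wdeg G w v) with h0 | hpos
  · rw [h0] at h3
    exact h1 (h3.mono le_rfl (del_le _ _ _))
  · obtain ⟨u, hu, hu0⟩ := Finset.exists_ne_zero_of_sum_ne_zero hpos.ne'
    have hadj : G.Adj v u := by simpa using hu
    exact h1 ((h3.succ_of_del hadj hv (Nat.pos_of_ne_zero hu0)).anti (by omega))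

theorem Sat.exists_adj [Fintype V] {G : SimpleGraph V} {w : V → ℕ} {t : ℕ} (h : Sat G w t) {v : V}
    (hv : 0 < w v) : ∃ u, G.Adj v u ∧ 0 < w u := by
  classical
  have h2 := h.two_le_wdeg hv
  obtain ⟨u, hu, hu0⟩ := Finset.exists_ne_zero_of_sum_ne_zero
    (show ∑ u with G.Adj v u, w u ≠ 0 from (by unfold wdeg at h2; omega))
  exact ⟨u, by simpa using hu, Nat.pos_of_ne_zero hu0⟩

theorem HasM.lower {G : SimpleGraph V} {w : V → ℕ} {m : ℕ} (h : HasM G w m) (v : V) :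
    HasM G (lower w v) (m - 1) := by
  classical
  obtain ⟨M, hM, rfl⟩ := h
  by_cases hv : edgeDeg M v ≤ w v - 1
  · refine HasM.anti ⟨M, ⟨hM.1, fun x => ?_⟩, rfl⟩ (Nat.sub_le _ _)
    unfold WeightedGraph.lower
    split_ifs with hx
    · exact hx ▸ hv
    · exact hM.2 x
  · obtain ⟨u, hu⟩ := exists_mem_of_edgeDeg_pos (show 0 < edgeDeg M v by omega)
    obtain ⟨N, rfl⟩ := Multiset.exists_cons_of_mem hu
    obtain ⟨-, -, -, h⟩ := isMat_cons.1 hM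
    exact HasM.mono ⟨N, h, by simp⟩ le_rfl (lower_le _ _)

theorem sum_lower [Fintype V] {w : V → ℕ} {v : V} (hv : 0 < w v) :
    ∑ x, lower w v x + 1 = ∑ x, w x := by
  classical
  have : ∀ x, w x = lower w v x + if x = v then 1 else 0 := by
    intro x
    unfold lower
    split_ifs with h
    · subst h; omega
    · rfl
  rw [Finset.sum_congr rfl fun x _ => this x]
  simp [Finset.sum_add_distrib]

/-- Lowering the weight of a vertex that is missed by no maximum matching. -/
theorem Sat.lower [Fintype V] {G : SimpleGraph V} {w : V → ℕ} {t s : ℕ} (h : Sat G w t) {v : V}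
    (hv : 0 < w v) (hs : HasM G w s) (hsv : ¬ HasM G (lower w v) s) :
    Sat G (lower w v) (t - 1) := by
  classical
  have hst : s < t := by
    by_contra hst
    exact h.1 (hs.anti (by omega))
  refine ⟨fun h' => hsv (h'.anti (by omega)), fun i hi => ?_⟩
  have hi' := h.2 i (hi.trans_le (lower_le _ _ _))
  by_cases hadj : G.Adj i v
  · have h1 : del G (WeightedGraph.lower w v) i = del G w i := by
      ext x
      unfold del WeightedGraph.lower
      by_cases hx : x = v
      · subst hx; simp [hadj]
      · simp [hx]
    have h2 : wdeg G (WeightedGraph.lower w v) i + 1 = wdeg G w i := by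
      unfold wdeg
      rw [sum_filter, sum_filter]
      rw [← sum_lower (w := fun u => if G.Adj i u then w u else 0) (v := v) (by simpa [hadj] using hv)]
      congr 1
      refine sum_congr rfl fun x _ => ?_
      unfold WeightedGraph.lower
      by_cases hx : x = v
      · subst hx; simp [hadj]
      · simp [hx]
    rw [h1]
    exact hi'.anti (by omega)
  · have h1 : del G (WeightedGraph.lower w v) i = WeightedGraph.lower (del G w i) v := by
      ext x
      unfold del WeightedGraph.lower
      by_cases hx : x = v
      · subst hx; simp [hadj]
      · simp [hx]
    have h2 : wdeg G (WeightedGraph.lower w v) i = wdeg G w i := by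
      refine sum_congr rfl fun x hx => ?_
      have : x ≠ v := by
        rintro rfl
        exact hadj (by simpa using hx)
      simp [WeightedGraph.lower, this]
    rw [h1, h2]
    exact (hi'.lower v).anti (by omega)

/-! ### Gallai's lemma -/

/-- No matching with `s` edges misses both `u` and `v` (twice, if `u = v`). -/
def Excl (G : SimpleGraph V) (w : V → ℕ) (s : ℕ) (u v : V) : Prop :=
  ∀ M, IsMat G w M → M.card = s → edgeDeg M u < w u → edgeDeg M v < w v →
    u = v ∧ w u = edgeDeg M u + 1

open Classical in
theorem exists_count_lt {M N : Multiset (Sym2 V)} {x : V}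
    (h : edgeDeg N x < edgeDeg M x) : ∃ y, N.count s(x, y) < M.count s(x, y) := by
  by_contra hc
  push Not at hc
  refine h.not_ge ?_
  unfold edgeDeg
  rw [Multiset.countP_eq_card_filter, Multiset.countP_eq_card_filter]
  refine Multiset.card_le_card (Multiset.le_iff_count.2 fun e => ?_)
  rw [Multiset.count_filter, Multiset.count_filter]
  split_ifs with he
  · obtain ⟨y, rfl⟩ := Sym2.mem_iff_exists.1 he
    convert hc y
  · rfl

open Classical in
theorem exists_count_lt_of_le {M N : Multiset (Sym2 V)} {x y : V}
    (h : edgeDeg M y ≤ edgeDeg N y) (hxy : N.count s(x, y) < M.count s(x, y)) :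
    ∃ z, M.count s(y, z) < N.count s(y, z) := by
  by_contra hc
  push Not at hc
  refine h.not_gt ?_
  unfold edgeDeg
  rw [Multiset.countP_eq_card_filter, Multiset.countP_eq_card_filter]
  refine Multiset.card_lt_card (lt_of_le_of_ne (Multiset.le_iff_count.2 fun e => ?_) fun he => ?_)
  · rw [Multiset.count_filter, Multiset.count_filter]
    split_ifs with he
    · obtain ⟨z, rfl⟩ := Sym2.mem_iff_exists.1 he
      convert hc z
    · rfl
  · have := congr_arg (Multiset.count s(x, y)) he
    rw [Multiset.count_filter_of_pos (by simp), Multiset.count_filter_of_pos (by simp)] at this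
    refine hxy.ne ?_
    convert this

theorem Excl.trans [Fintype V] {G : SimpleGraph V} {w : V → ℕ} {s : ℕ} {u t v : V}
    (hut : Excl G w s u t) (htv : Excl G w s t v) (ht : 0 < w t) (hst : HasM G (lower w t) s)
    (hmax : ¬ HasM G w (s + 1)) : Excl G w s u v := by
  classical
  intro M hM hMs hMu hMv
  by_contra hne
  have hMt : edgeDeg M t = w t := by
    by_contra hlt
    have hlt := lt_of_le_of_ne (hM.2 t) hlt
    obtain ⟨rfl, h1⟩ := hut M hM hMs hMu hlt
    obtain ⟨rfl, h2⟩ := htv M hM hMs hMu hMv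
    exact hne ⟨rfl, h1⟩
  have htu : u ≠ t := by rintro rfl; omega
  have htv' : t ≠ v := by rintro rfl; omega
  have key : ∀ n, ∃ N, IsMat G w N ∧ N.card = s ∧ edgeDeg N t < w t ∧ n ≤ (M ∩ N).card := by
    intro n
    induction n with
    | zero =>
      obtain ⟨N, hN, hNs⟩ := hst
      refine ⟨N, ⟨hN.1, fun x => (hN.2 x).trans (lower_le _ _ _)⟩, hNs, ?_, Nat.zero_le _⟩
      have := hN.2 t
      simp only [WeightedGraph.lower, if_true] at this
      omega
    | succ n ih =>
      obtain ⟨N, hN, hNs, hNt, hn⟩ := ih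
      have hNu : edgeDeg N u = w u := by
        by_contra hlt
        exact htu (hut N hN hNs (lt_of_le_of_ne (hN.2 u) hlt) hNt).1
      have hNv : edgeDeg N v = w v := by
        by_contra hlt
        exact htv' (htv N hN hNs hNt (lt_of_le_of_ne (hN.2 v) hlt)).1
      obtain ⟨x, hx, hxt⟩ : ∃ x, edgeDeg N x < edgeDeg M x ∧ (x = t → edgeDeg N t + 2 ≤ w t) := by
        by_contra hc
        push Not at hc
        have h1 : ∀ x, edgeDeg M x + ((if x = u then 1 else 0) + if x = v then 1 else 0) ≤
            edgeDeg N x + if x = t then 1 else 0 := by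
          intro x
          have hcx := hc x
          by_cases hxt : x = t
          · subst hxt
            simp only [htu.symm, htv', if_false, if_true]
            by_cases h2 : edgeDeg N x < edgeDeg M x
            · have := (hcx h2).2; omega
            · omega
          · have h2 : edgeDeg M x ≤ edgeDeg N x := by
              by_contra h2
              exact hxt (hcx (by omega)).1
            by_cases hxu : x = u <;> by_cases hxv : x = v
            · subst hxu; subst hxv
              have : w x ≠ edgeDeg M x + 1 := fun h => hne ⟨rfl, h⟩
              simp only [if_true, hxt, if_false]
              omega
            · subst hxu; simp only [hxv, if_true, hxt, if_false]; omega
            · subst hxv; simp only [hxu, if_true, hxt, if_false]; omega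
            · simp only [hxu, hxv, hxt, if_false]; omega
        have h2 := Finset.sum_le_sum fun x (_ : x ∈ univ) => h1 x
        simp only [Finset.sum_add_distrib, sum_edgeDeg hM, sum_edgeDeg hN, Finset.sum_ite_eq',
          mem_univ, if_true, hMs, hNs] at h2
        omega
      obtain ⟨y, hy⟩ := exists_count_lt hx
      have hxyM : s(x, y) ∈ M := Multiset.count_pos.1 (by omega)
      have hadj := (hM.adj hxyM).1
      have hNx : edgeDeg N x < w x := hx.trans_le (hM.2 x)
      have hNy : edgeDeg N y = w y := by
        by_contra hlt
        exact hmax ⟨_, hN.cons hadj hNx (lt_of_le_of_ne (hN.2 y) hlt), by simp [hNs]⟩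
      obtain ⟨z, hz⟩ := exists_count_lt_of_le ((hM.2 y).trans hNy.ge) hy
      have hyz : s(y, z) ∈ N := Multiset.count_pos.1 (by omega)
      have hne' : s(x, y) ≠ s(y, z) := by
        intro h
        rw [h] at hy
        omega
      obtain ⟨N, rfl⟩ := Multiset.exists_cons_of_mem hyz
      have hyt : t ≠ y := by rintro rfl; omega
      simp only [edgeDeg_cons, Sym2.mem_iff, true_or, if_true] at hNx hNy hNt hxt
      have hN' : IsMat G w N := hN.of_le (Multiset.le_cons_self _ _)
      refine ⟨s(x, y) ::ₘ N, hN'.cons hadj (by omega) (by omega), by simpa using hNs, ?_, ?_⟩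
      · rw [edgeDeg_cons]
        by_cases hx' : x = t
        · have := hxt hx'
          split_ifs <;> omega
        · simp only [Sym2.mem_iff, Ne.symm hx', hyt, or_self, if_false]
          omega
      · have hle : s(x, y) ::ₘ (M ∩ (s(y, z) ::ₘ N)) ≤ M ∩ (s(x, y) ::ₘ N) := by
          refine Multiset.le_iff_count.2 fun e => ?_
          simp only [Multiset.count_cons, Multiset.count_inter] at hy hz ⊢
          simp only [hne', if_false, if_true] at hy hz
          by_cases h1 : e = s(x, y)
          · subst h1; simp only [hne', if_false, if_true]; omega
          · by_cases h2 : e = s(y, z)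
            · subst h2; simp only [hne'.symm, if_false, if_true]; omega
            · simp [h1, h2]
        have := Multiset.card_le_card hle
        rw [Multiset.card_cons] at this
        omega
  obtain ⟨N, -, -, -, hN⟩ := key (s + 1)
  have := Multiset.card_le_card (Multiset.inter_le_left (s := M) (t := N))
  omega

/-! ### Components of weighted graphs without essential vertices -/

/-- The graph `G` with all edges at vertices of weight zero removed. -/
def suppGraph (G : SimpleGraph V) (w : V → ℕ) : SimpleGraph V where
  Adj a b := G.Adj a b ∧ 0 < w a ∧ 0 < w b
  symm := ⟨fun _ _ h => ⟨h.1.symm, h.2.2, h.2.1⟩⟩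
  loopless := ⟨fun _ h => h.1.ne rfl⟩

theorem excl_of_adj {G : SimpleGraph V} {w : V → ℕ} {s : ℕ} (hmax : ¬ HasM G w (s + 1)) {u v : V}
    (h : G.Adj u v) : Excl G w s u v :=
  fun _ hM hs hu hv => (hmax ⟨_, hM.cons h hu hv, by simp [hs]⟩).elim

/-- `s` is the matching number of `(G, w)`, no vertex is essential for it, and no vertex is
isolated. -/
structure NoEssential (G : SimpleGraph V) (w : V → ℕ) (s : ℕ) : Prop where
  not_hasM : ¬ HasM G w (s + 1)
  hasM_lower : ∀ v, 0 < w v → HasM G (lower w v) s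
  exists_adj : ∀ v, 0 < w v → ∃ u, G.Adj v u ∧ 0 < w u

variable {G : SimpleGraph V} {w : V → ℕ} {s : ℕ}

theorem NoEssential.excl_of_reachable [Fintype V] (h : NoEssential G w s) {u v : V} (hu : 0 < w u)
    (huv : (suppGraph G w).Reachable u v) : Excl G w s u v := by
  rw [SimpleGraph.reachable_iff_reflTransGen] at huv
  induction huv with
  | refl =>
    obtain ⟨t, ht, ht0⟩ := h.exists_adj u hu
    exact (excl_of_adj h.not_hasM ht).trans (excl_of_adj h.not_hasM ht.symm) ht0
      (h.hasM_lower t ht0) h.not_hasM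
  | tail _ hbc ih =>
    exact ih.trans (excl_of_adj h.not_hasM hbc.1) hbc.2.1 (h.hasM_lower _ hbc.2.1) h.not_hasM

open Classical in
/-- The vertices of a component. -/
noncomputable def compFinset [Fintype V] (H : SimpleGraph V) (c : H.ConnectedComponent) :
    Finset V :=
  {x | H.connectedComponentMk x = c}

theorem mem_compFinset [Fintype V] {H : SimpleGraph V} {c : H.ConnectedComponent} {x : V} :
    x ∈ compFinset H c ↔ H.connectedComponentMk x = c := by
  simp [compFinset]

theorem mem_compFinset_iff_of_adj [Fintype V] {H : SimpleGraph V} {c : H.ConnectedComponent}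
    {x y : V} (h : H.Adj x y) : x ∈ compFinset H c ↔ y ∈ compFinset H c := by
  rw [mem_compFinset, mem_compFinset, SimpleGraph.ConnectedComponent.sound h.reachable]

open Classical in
theorem sum_compFinset [Fintype V] (H : SimpleGraph V) (f : V → ℕ) :
    ∑ c, ∑ x ∈ compFinset H c, f x = ∑ x, f x :=
  Finset.sum_fiberwise _ _ _

theorem even_sum_compFinset [Fintype V] {M : Multiset (Sym2 V)} (hM : IsMat G w M)
    (c : (suppGraph G w).ConnectedComponent) :
    Even (∑ x ∈ compFinset _ c, edgeDeg M x) := by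
  classical
  rw [sum_edgeDeg_of_closed]
  · exact even_two_mul _
  · intro a b hab
    exact ⟨(hM.adj hab).1.ne, mem_compFinset_iff_of_adj (hM.adj hab)⟩

/-- In each component a maximum matching misses at most one vertex, and if it misses one, then it
has an edge there. -/
theorem NoEssential.sum_compFinset_le [Fintype V] (h : NoEssential G w s) {M : Multiset (Sym2 V)}
    (hM : IsMat G w M) (hs : M.card = s) (c : (suppGraph G w).ConnectedComponent) :
    (∑ x ∈ compFinset _ c, w x = ∑ x ∈ compFinset _ c, edgeDeg M x) ∨
    (∑ x ∈ compFinset _ c, w x = ∑ x ∈ compFinset _ c, edgeDeg M x + 1 ∧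
      2 ≤ ∑ x ∈ compFinset _ c, edgeDeg M x) := by
  classical
  by_cases hall : ∀ x ∈ compFinset _ c, edgeDeg M x = w x
  · exact Or.inl (sum_congr rfl fun x hx => (hall x hx).symm)
  · right
    push Not at hall
    obtain ⟨u, hu, hne⟩ := hall
    have hlt : edgeDeg M u < w u := lt_of_le_of_ne (hM.2 u) hne
    have hpos : 0 < w u := by omega
    have hex : ∀ x ∈ compFinset _ c, Excl G w s u x := by
      intro x hx
      rw [mem_compFinset] at hu hx
      exact h.excl_of_reachable hpos (SimpleGraph.ConnectedComponent.exact (hu.trans hx.symm))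
    constructor
    · have h1 : ∀ x ∈ compFinset _ c, w x = edgeDeg M x + if x = u then 1 else 0 := by
        intro x hx
        have := hM.2 x
        split_ifs with hxu
        · subst hxu; exact (hex x hx M hM hs hlt hlt).2
        · by_contra hx'
          exact hxu (hex x hx M hM hs hlt (by omega)).1.symm
      rw [sum_congr rfl h1, sum_add_distrib, sum_ite_eq' , if_pos hu]
    · obtain ⟨t, ht, ht0⟩ := h.exists_adj u hpos
      have htc : t ∈ compFinset _ c :=
        (mem_compFinset_iff_of_adj (H := suppGraph G w) ⟨ht, hpos, ht0⟩).1 hu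
      have h1 : edgeDeg M t = w t := by
        by_contra h1
        exact ht.ne (hex t htc M hM hs hlt (lt_of_le_of_ne (hM.2 t) h1)).1
      have h2 := single_le_sum (f := edgeDeg M) (fun _ _ => Nat.zero_le _) htc
      obtain ⟨r, hr⟩ := even_sum_compFinset hM c
      omega

theorem NoEssential.sum_le [Fintype V] (h : NoEssential G w s) (hs : HasM G w s) :
    ∑ x, w x ≤ 3 * s := by
  classical
  obtain ⟨M, hM, hMs⟩ := hs
  have h1 : 2 * ∑ x, w x ≤ 3 * ∑ x, edgeDeg M x := by
    rw [← sum_compFinset (suppGraph G w), ← sum_compFinset (suppGraph G w), mul_sum, mul_sum]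
    refine sum_le_sum fun c _ => ?_
    have := h.sum_compFinset_le hM hMs c
    omega
  rw [sum_edgeDeg hM] at h1
  omega

theorem exists_max (G : SimpleGraph V) (w : V → ℕ) {t : ℕ} (h : ¬ HasM G w t) :
    ∃ s < t, HasM G w s ∧ ¬ HasM G w (s + 1) := by
  induction t with
  | zero => exact (h (HasM.zero G w)).elim
  | succ t ih =>
    by_cases ht : HasM G w t
    · exact ⟨t, t.lt_succ_self, ht, h⟩
    · obtain ⟨s, h1, h2⟩ := ih ht
      exact ⟨s, by omega, h2⟩

theorem Sat.noEssential_or [Fintype V] {t : ℕ} (h : Sat G w t) (hs : HasM G w s)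
    (hs' : ¬ HasM G w (s + 1)) :
    NoEssential G w s ∨ ∃ v, 0 < w v ∧ Sat G (WeightedGraph.lower w v) (t - 1) := by
  by_cases hv : ∀ v, 0 < w v → HasM G (WeightedGraph.lower w v) s
  · exact Or.inl ⟨hs', hv, fun v hv => h.exists_adj hv⟩
  · push Not at hv
    obtain ⟨v, hv, hv'⟩ := hv
    exact Or.inr ⟨v, hv, h.lower hv hs hv'⟩

/-- The total weight of a `t`-saturating weighted graph is at most `3 (t - 1)`. -/
theorem Sat.sum_le [Fintype V] {t : ℕ} (h : Sat G w t) : ∑ x, w x + 3 ≤ 3 * t := by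
  induction t generalizing w with
  | zero => exact (h.1 (HasM.zero _ _)).elim
  | succ t ih =>
    obtain ⟨s, hst, hs, hs'⟩ := exists_max G w h.1
    rcases h.noEssential_or hs hs' with h' | ⟨v, hv, h'⟩
    · have := h'.sum_le hs
      omega
    · have := ih h'
      have := sum_lower hv
      omega

/-! ### Triangle components -/

/-- `T` is a triangle with all weights one which is a component. -/
structure IsTriangleComp (G : SimpleGraph V) (w : V → ℕ) (T : Finset V) : Prop where
  card : T.card = 3
  weight : ∀ a ∈ T, w a = 1
  adj : ∀ a ∈ T, ∀ b ∈ T, a ≠ b → G.Adj a b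
  not_adj : ∀ a ∈ T, ∀ b ∉ T, 0 < w b → ¬ G.Adj a b

theorem Sat.exists_isTriangleComp [Fintype V] {t : ℕ} (h : Sat G w t) (ht : t ≤ 4)
    (hn : 2 * t ≤ ∑ x, w x) : ∃ T, IsTriangleComp G w T := by
  classical
  obtain ⟨s, hst, hs, hs'⟩ := exists_max G w h.1
  rcases h.noEssential_or hs hs' with h' | ⟨v, hv, h'⟩
  swap
  · have := h'.sum_le
    have := sum_lower hv
    omega
  obtain ⟨M, hM, hMs⟩ := hs
  obtain ⟨c, hc⟩ : ∃ c, ∑ x ∈ compFinset (suppGraph G w) c, w x = 3 := by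
    by_contra hc
    push Not at hc
    have h1 : 4 * ∑ x, w x ≤ 5 * ∑ x, edgeDeg M x := by
      rw [← sum_compFinset (suppGraph G w), ← sum_compFinset (suppGraph G w), mul_sum, mul_sum]
      refine sum_le_sum fun c _ => ?_
      have h2 := h'.sum_compFinset_le hM hMs c
      have h3 := hc c
      obtain ⟨r, hr⟩ := even_sum_compFinset hM c
      omega
    rw [sum_edgeDeg hM] at h1
    omega
  set T := {x ∈ compFinset (suppGraph G w) c | 0 < w x} with hT
  have hsum : ∑ x ∈ T, w x = 3 := by
    rw [← hc]
    refine sum_filter_of_ne fun x _ hx => Nat.pos_of_ne_zero hx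
  have hclosed : ∀ a ∈ T, ∀ b, G.Adj a b → 0 < w b → b ∈ T := by
    intro a ha b hab hb
    rw [hT, mem_filter] at ha ⊢
    exact ⟨(mem_compFinset_iff_of_adj (H := suppGraph G w) ⟨hab, ha.2, hb⟩).1 ha.1, hb⟩
  have hdeg : ∀ a ∈ T, 2 ≤ ∑ u ∈ T.erase a with G.Adj a u, w u := by
    intro a ha
    refine (h.two_le_wdeg (mem_filter.1 ha).2).trans ?_
    unfold wdeg
    rw [← sum_filter_ne_zero]
    refine sum_le_sum_of_subset fun u hu => ?_
    simp only [mem_filter, mem_univ, true_and, mem_erase] at hu ⊢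
    exact ⟨⟨hu.1.ne', hclosed a ha u hu.1 (Nat.pos_of_ne_zero hu.2)⟩, hu.1⟩
  have hone : ∀ a ∈ T, w a = 1 := by
    intro a ha
    have h1 := hdeg a ha
    have h2 : ∑ u ∈ T.erase a with G.Adj a u, w u ≤ ∑ u ∈ T.erase a, w u :=
      sum_le_sum_of_subset (filter_subset _ _)
    have h3 := add_sum_erase T w ha
    have h4 := (mem_filter.1 ha).2
    omega
  have hcard : T.card = 3 := by
    rw [← hsum, sum_congr rfl hone]
    simp
  refine ⟨T, hcard, hone, fun a ha b hb hab => ?_, fun a ha b hb hwb hadj =>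
    hb (hclosed a ha b hadj hwb)⟩
  by_contra hadj
  have h1 := hdeg a ha
  have h2 : ∑ u ∈ T.erase a with G.Adj a u, w u ≤ ∑ u ∈ (T.erase a).erase b, w u := by
    refine sum_le_sum_of_subset fun u hu => ?_
    simp only [mem_filter, mem_erase] at hu ⊢
    exact ⟨fun h => hadj (h ▸ hu.2), hu.1⟩
  have h3 := add_sum_erase T w ha
  have h4 := add_sum_erase (T.erase a) w (mem_erase.2 ⟨hab.symm, hb⟩)
  have := hone a ha
  have := hone b hb
  omega

open Classical in
/-- The weight function `w` with the weights on `T` replaced by zero. -/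
noncomputable def zeroOn (w : V → ℕ) (T : Finset V) : V → ℕ := fun x => if x ∈ T then 0 else w x

namespace IsTriangleComp

variable {T : Finset V}

theorem hasM_succ (h : IsTriangleComp G w T) {m : ℕ} (hm : HasM G (zeroOn w T) m) :
    HasM G w (m + 1) := by
  classical
  obtain ⟨M, hM, rfl⟩ := hm
  obtain ⟨a, ha, b, hb, hab⟩ := one_lt_card.1 (show 1 < T.card by rw [h.card]; omega)
  have h0 : ∀ x ∈ T, edgeDeg M x < w x := by
    intro x hx
    have := hM.2 x
    rw [zeroOn, if_pos hx] at this
    rw [h.weight x hx]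
    omega
  have hM' : IsMat G w M := ⟨hM.1, fun x => (hM.2 x).trans (by unfold zeroOn; split <;> omega)⟩
  exact ⟨_, hM'.cons (h.adj a ha b hb hab) (h0 a ha) (h0 b hb), by simp⟩

theorem hasM_zeroOn (h : IsTriangleComp G w T) {m : ℕ} (hm : HasM G w m) :
    HasM G (zeroOn w T) (m - 1) := by
  classical
  obtain ⟨M, hM, rfl⟩ := hm
  have h1 := sum_edgeDeg_of_closed T M fun a b hab => by
    obtain ⟨h1, h2, h3⟩ := hM.adj hab
    refine ⟨h1.ne, fun ha => ?_, fun hb => ?_⟩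
    · by_contra hb
      exact h.not_adj a ha b hb h3 h1
    · by_contra ha
      exact h.not_adj b hb a ha h2 h1.symm
  have h2 : ∑ x ∈ T, edgeDeg M x ≤ 3 := by
    rw [← h.card, card_eq_sum_ones]
    exact sum_le_sum fun x hx => (hM.2 x).trans (h.weight x hx).le
  have h3 := Multiset.card_eq_countP_add_countP (fun e : Sym2 V => ∃ x ∈ e, x ∈ T) M
  set N := M.filter fun e : Sym2 V => ¬ ∃ x ∈ e, x ∈ T with hN
  have hNM : IsMat G w N := hM.of_le (Multiset.filter_le _ _)
  have hNc : N.card = M.countP fun e : Sym2 V => ¬ ∃ x ∈ e, x ∈ T :=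
    (Multiset.countP_eq_card_filter _ _).symm
  refine HasM.anti ⟨N, ⟨hNM.1, fun x => ?_⟩, rfl⟩ (by omega)
  unfold zeroOn
  split_ifs with hx
  · by_contra hpos
    obtain ⟨u, hu⟩ := exists_mem_of_edgeDeg_pos (show 0 < edgeDeg N x by omega)
    exact (Multiset.mem_filter.1 hu).2 ⟨x, by simp, hx⟩
  · exact hNM.2 x

theorem del (h : IsTriangleComp G w T) {v : V} (hv : v ∉ T) (hv0 : 0 < w v) :
    IsTriangleComp G (del G w v) T := by
  refine ⟨h.card, fun a ha => ?_, h.adj, fun a ha b hb hb0 =>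
    h.not_adj a ha b hb (hb0.trans_le (del_le _ _ _ _))⟩
  have : ¬ G.Adj v a := fun h' => h.not_adj a ha v hv hv0 h'.symm
  simp [WeightedGraph.del, this, h.weight a ha]

theorem sat_iff [Fintype V] (h : IsTriangleComp G w T) (t : ℕ) :
    Sat G w (t + 2) ↔ Sat G (zeroOn w T) (t + 1) ∧ HasM G (zeroOn w T) t := by
  classical
  have h1 : HasM G w (t + 2) ↔ HasM G (zeroOn w T) (t + 1) :=
    ⟨fun h' => h.hasM_zeroOn h', fun h' => h.hasM_succ h'⟩
  have hwdeg : ∀ v ∉ T, 0 < w v → wdeg G (zeroOn w T) v = wdeg G w v := by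
    intro v hv hv0
    refine sum_congr rfl fun x hx => ?_
    have : x ∉ T := fun hxT => h.not_adj x hxT v hv hv0 (by simpa using (mem_filter.1 hx).2.symm)
    simp [zeroOn, this]
  have hdel : ∀ v, WeightedGraph.del G (zeroOn w T) v = zeroOn (WeightedGraph.del G w v) T := by
    intro v
    ext x
    simp only [WeightedGraph.del, zeroOn]
    split_ifs <;> rfl
  have hout : ∀ v ∉ T, 0 < w v →
      (HasM G (WeightedGraph.del G w v) (t + 2 - wdeg G w v) ↔
        HasM G (WeightedGraph.del G (zeroOn w T) v) (t + 1 - wdeg G (zeroOn w T) v)) := by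
    intro v hv hv0
    rw [hwdeg v hv hv0, hdel]
    exact ⟨fun h' => ((h.del hv hv0).hasM_zeroOn h').anti (by omega),
      fun h' => ((h.del hv hv0).hasM_succ h').anti (by omega)⟩
  have hin : ∀ v ∈ T, (HasM G (WeightedGraph.del G w v) (t + 2 - wdeg G w v) ↔
      HasM G (zeroOn w T) t) := by
    intro v hv
    have h2 : wdeg G w v = 2 := by
      unfold wdeg
      rw [← sum_filter_ne_zero]
      have : ({u ∈ ({u | G.Adj v u} : Finset V) | w u ≠ 0}) = T.erase v := by
        ext u
        simp only [mem_filter, mem_univ, true_and, mem_erase]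
        constructor
        · rintro ⟨h3, h4⟩
          refine ⟨h3.ne', ?_⟩
          by_contra hu
          exact h.not_adj v hv u hu (Nat.pos_of_ne_zero h4) h3
        · rintro ⟨h3, h4⟩
          exact ⟨h.adj v hv u h4 h3.symm, by simp [h.weight u h4]⟩
      rw [this, sum_congr rfl fun x hx => h.weight x (mem_of_mem_erase hx)]
      simp [card_erase_of_mem hv, h.card]
    rw [h2, Nat.add_sub_cancel]
    have h3 : ∀ x, x ≠ v → WeightedGraph.del G w v x = zeroOn w T x := by
      intro x hxv
      unfold WeightedGraph.del zeroOn
      by_cases hx : x ∈ T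
      · simp [hx, h.adj v hv x hx hxv.symm]
      · by_cases hx' : G.Adj v x
        · have : w x = 0 := by
            by_contra h4
            exact h.not_adj v hv x hx (Nat.pos_of_ne_zero h4) hx'
          simp [this]
        · simp [hx, hx']
    constructor
    · rintro ⟨M, hM, rfl⟩
      refine ⟨M, ⟨hM.1, fun x => ?_⟩, rfl⟩
      by_cases hxv : x = v
      · subst hxv
        rw [edgeDeg_del_self hM]
        exact Nat.zero_le _
      · rw [← h3 x hxv]
        exact hM.2 x
    · refine fun h' => h'.mono le_rfl fun x => ?_
      by_cases hxv : x = v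
      · subst hxv
        simp [zeroOn, hv]
      · rw [h3 x hxv]
  obtain ⟨a, ha⟩ := card_pos.1 (show 0 < T.card by rw [h.card]; omega)
  unfold Sat
  rw [h1, and_assoc]
  refine and_congr Iff.rfl ⟨fun h' => ⟨fun v hv => ?_, (hin a ha).1 (h' a (by simp [h.weight a ha]))⟩,
    fun h' v hv => ?_⟩
  · have hvT : v ∉ T := fun hvT => by simp [zeroOn, hvT] at hv
    have hv0 : 0 < w v := by simpa [zeroOn, hvT] using hv
    exact (hout v hvT hv0).1 (h' v hv0)
  · by_cases hvT : v ∈ T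
    · exact (hin v hvT).2 h'.2
    · exact (hout v hvT hv).2 (h'.1 v (by simpa [zeroOn, hvT] using hv))

end IsTriangleComp

/-! ### Monotonicity of the saturation condition -/

theorem HasM.zeroOn {G : SimpleGraph V} {w : V → ℕ} {m : ℕ} (h : HasM G w m) (S : Finset V) :
    HasM G (zeroOn w S) (m - ∑ x ∈ S, w x) := by
  classical
  induction S using Finset.induction_on with
  | empty =>
    have : WeightedGraph.zeroOn w ∅ = w := by ext; simp [WeightedGraph.zeroOn]
    simpa [this] using h
  | insert a S ha ih =>
    obtain ⟨M, hM, hc⟩ := ih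
    rw [sum_insert ha]
    have h1 := Multiset.card_eq_countP_add_countP (fun e : Sym2 V => a ∈ e) M
    have h2 : (M.filter fun e : Sym2 V => ¬ a ∈ e).card = M.countP fun e : Sym2 V => ¬ a ∈ e :=
      (Multiset.countP_eq_card_filter _ _).symm
    have h3 : M.countP (fun e : Sym2 V => a ∈ e) ≤ w a := by
      have := hM.2 a
      simp only [WeightedGraph.zeroOn, ha, if_false] at this
      unfold edgeDeg at this
      convert this
    have h4 := hM.of_le (Multiset.filter_le (fun e : Sym2 V => ¬ a ∈ e) M)
    refine HasM.anti ⟨_, ⟨h4.1, fun x => ?_⟩, rfl⟩ (show _ ≤ _ by rw [h2]; omega)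
    by_cases hx : x = a
    · subst hx
      by_contra hpos
      obtain ⟨u, hu⟩ := exists_mem_of_edgeDeg_pos (Nat.pos_of_ne_zero fun h0 => hpos (h0 ▸ Nat.zero_le _))
      exact (Multiset.mem_filter.1 hu).2 (by simp)
    · refine (h4.2 x).trans (le_of_eq ?_)
      simp [WeightedGraph.zeroOn, hx]

theorem hasM_zeroOn_of_del [Fintype V] {G : SimpleGraph V} {w : V → ℕ} {t : ℕ} {v : V}
    (h : HasM G (del G w v) (t - wdeg G w v)) (S : Finset V) (hS : ∀ u, G.Adj v u → u ∈ S) :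
    HasM G (zeroOn w S) (t - ∑ x ∈ S, w x) := by
  classical
  have h1 := h.zeroOn S
  have h2 : zeroOn (del G w v) S = zeroOn w S := by
    ext x
    unfold zeroOn del
    by_cases hx : x ∈ S
    · simp [hx]
    · have : ¬ G.Adj v x := fun h => hx (hS x h)
      simp [hx, this]
  have h3 : wdeg G w v + ∑ x ∈ S, del G w v x = ∑ x ∈ S, w x := by
    have h4 : wdeg G w v = ∑ x ∈ S with G.Adj v x, w x := by
      unfold wdeg
      congr 1
      ext x
      simp only [mem_filter, mem_univ, true_and]
      exact ⟨fun h => ⟨hS x h, h⟩, fun h => h.2⟩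
    rw [h4, sum_filter, ← sum_add_distrib]
    refine sum_congr rfl fun x _ => ?_
    unfold del
    split_ifs <;> omega
  rw [h2] at h1
  exact h1.anti (by omega)

theorem hasM_del_mono [Fintype V] {G H : SimpleGraph V} {w : V → ℕ} {t : ℕ} {v : V} (hGH : G ≤ H)
    (h : HasM G (del G w v) (t - wdeg G w v)) : HasM H (del H w v) (t - wdeg H w v) := by
  classical
  refine ((hasM_zeroOn_of_del h {u | H.Adj v u} fun u hu => by simpa using hGH hu).anti
    le_rfl).mono hGH fun x => ?_
  unfold zeroOn del
  simp

/-! ### Boolean tests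

Graphs on `0, …, k - 1` are encoded as natural numbers: the bit `8 a + b` tells whether `a` and `b`
are adjacent. The definitions use recursors and binary operations on literals, and `force` evaluates
an argument, so that the kernel computes with them quickly. -/

noncomputable section

def force {α : Type} (n : ℕ) (f : ℕ → α) : α := Nat.rec (f 0) (fun m _ => f (Nat.succ m)) n

@[simp] theorem force_eq {α : Type} (n : ℕ) (f : ℕ → α) : force n f = f n := by cases n <;> rfl

def anyB (k : ℕ) (f : ℕ → Bool) : Bool := Nat.rec false (fun i r => Bool.rec r true (f i)) k

def allB (k : ℕ) (f : ℕ → Bool) : Bool := Nat.rec true (fun i r => Bool.rec false r (f i)) k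

def sumB (k : ℕ) (f : ℕ → ℕ) : ℕ := Nat.rec 0 (fun i r => Nat.add (f i) r) k

theorem anyB_eq_true {k : ℕ} {f : ℕ → Bool} : anyB k f = true ↔ ∃ i < k, f i = true := by
  induction k with
  | zero => simp [anyB]
  | succ k ih =>
    have : anyB (k + 1) f = Bool.rec (anyB k f) true (f k) := rfl
    rw [this]
    cases h : f k
    · simp only [ih]
      refine exists_congr fun i => and_congr_left fun hi => ⟨fun h => by omega, fun h' => ?_⟩
      rcases Nat.lt_succ_iff_lt_or_eq.1 h' with h' | rfl
      · exact h'
      · simp [h] at hi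
    · exact iff_of_true rfl ⟨k, by omega, h⟩

theorem allB_eq_true {k : ℕ} {f : ℕ → Bool} : allB k f = true ↔ ∀ i < k, f i = true := by
  induction k with
  | zero => simp [allB]
  | succ k ih =>
    have : allB (k + 1) f = Bool.rec false (allB k f) (f k) := rfl
    rw [this]
    cases h : f k
    · simp only [Bool.false_eq_true, false_iff, not_forall]
      exact ⟨k, by omega, by simp [h]⟩
    · simp only [ih]
      refine ⟨fun h' i hi => ?_, fun h' i hi => h' i (by omega)⟩
      rcases Nat.lt_succ_iff_lt_or_eq.1 hi with hi | rfl
      · exact h' i hi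
      · exact h

theorem sumB_eq (k : ℕ) (f : ℕ → ℕ) : sumB k f = ∑ i : Fin k, f i := by
  rw [Fin.sum_univ_eq_sum_range]
  induction k with
  | zero => rfl
  | succ k ih =>
    rw [sum_range_succ, ← ih]
    exact Nat.add_comm (f k) (sumB k f)

def bit (P a b : ℕ) : Bool :=
  Nat.beq (Nat.land (Nat.shiftRight P (Nat.add (Nat.mul 8 a) b)) 1) 1

def edgeBits (a b : ℕ) : ℕ :=
  Nat.lor (Nat.shiftLeft 1 (Nat.add (Nat.mul 8 a) b)) (Nat.shiftLeft 1 (Nat.add (Nat.mul 8 b) a))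

theorem bit_eq_testBit (P a b : ℕ) : bit P a b = P.testBit (8 * a + b) := by
  have h : (1 &&& P >>> (8 * a + b)) < 2 := by
    rw [Nat.and_comm, Nat.and_one_is_mod]; omega
  rw [Bool.eq_iff_iff, bit, Nat.beq_eq, Nat.testBit, bne_iff_ne]
  change (P >>> (8 * a + b)) &&& 1 = 1 ↔ _
  rw [Nat.and_comm]
  omega

theorem bit_edgeBits {a b c d : ℕ} (ha : a < 8) (hb : b < 8) (hd : d < 8) :
    bit (edgeBits a b) c d = true ↔ (c = a ∧ d = b) ∨ (c = b ∧ d = a) := by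
  have h : edgeBits a b = (1 <<< (8 * a + b)) ||| (1 <<< (8 * b + a)) := rfl
  rw [bit_eq_testBit, h, Nat.testBit_or, Bool.or_eq_true, Nat.one_shiftLeft, Nat.one_shiftLeft,
    Nat.testBit_two_pow, Nat.testBit_two_pow, decide_eq_true_iff, decide_eq_true_iff]
  omega

theorem bit_lor (P e a b : ℕ) : bit (Nat.lor P e) a b = (bit P a b || bit e a b) := by
  simp only [bit_eq_testBit]
  exact Nat.testBit_or _ _ _

theorem bit_xor (P e a b : ℕ) : bit (Nat.xor P e) a b = (bit P a b ^^ bit e a b) := by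
  simp only [bit_eq_testBit]
  exact Nat.testBit_xor _ _ _

/-- A test for the existence of a matching with `m` edges. -/
def hasMB (k P m : ℕ) : (ℕ → ℕ) → Bool :=
  Nat.rec (fun _ => true) (fun _ ih w => anyB k fun a =>
    Bool.rec (anyB a fun b => Bool.rec false (Bool.rec (ih fun u =>
      Bool.rec (Bool.rec (w u) (Nat.pred (w u)) (Nat.beq u b)) (Nat.pred (w u)) (Nat.beq u a))
      false (Nat.beq (w b) 0)) (bit P a b)) false (Nat.beq (w a) 0)) m

theorem hasMB_succ {k P m : ℕ} {w : ℕ → ℕ} : hasMB k P (m + 1) w = true ↔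
    ∃ a < k, w a ≠ 0 ∧ ∃ b < a, bit P a b = true ∧ w b ≠ 0 ∧
      hasMB k P m (fun u => if u = a ∨ u = b then w u - 1 else w u) = true := by
  have h0 : hasMB k P (m + 1) w = anyB k fun a =>
    Bool.rec (anyB a fun b => Bool.rec false (Bool.rec (hasMB k P m fun u =>
      Bool.rec (Bool.rec (w u) (Nat.pred (w u)) (Nat.beq u b)) (Nat.pred (w u)) (Nat.beq u a))
      false (Nat.beq (w b) 0)) (bit P a b)) false (Nat.beq (w a) 0) := rfl
  have hrec : ∀ x y z : Bool, (Bool.rec x y z : Bool) = if z = true then y else x := by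
    intro x y z; cases z <;> rfl
  have hrec' : ∀ (x y : ℕ) (z : Bool), (Bool.rec x y z : ℕ) = if z = true then y else x := by
    intro x y z; cases z <;> rfl
  rw [h0, anyB_eq_true]
  simp only [hrec, hrec', Nat.beq_eq]
  refine exists_congr fun a => and_congr_right fun _ => ?_
  by_cases ha : w a = 0
  · simp [ha]
  · simp only [ha, if_false, anyB_eq_true, ne_eq, not_false_eq_true, true_and]
    refine exists_congr fun b => and_congr_right fun _ => ?_
    have hf : (fun u => if u = a then (w u).pred else if u = b then (w u).pred else w u) =
        fun u => if u = a ∨ u = b then w u - 1 else w u := by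
      ext u
      by_cases h1 : u = a <;> by_cases h2 : u = b <;> simp [h1, h2]
    rw [hf]
    by_cases hb : w b = 0 <;> cases hP : bit P a b <;> simp [hb]

theorem hasMB_of_hasM {k P m : ℕ} {G : SimpleGraph (Fin k)} {w : ℕ → ℕ}
    (hP : ∀ a b, G.Adj a b → bit P a b = true) (h : HasM G (fun i => w i) m) :
    hasMB k P m w = true := by
  induction m generalizing w with
  | zero => rfl
  | succ m ih =>
    obtain ⟨a, b, hab, ha, hb, h⟩ := hasM_succ.1 h
    wlog hlt : b < a generalizing a b
    · refine this b a hab.symm hb ha ?_ (lt_of_le_of_ne (not_lt.1 hlt) hab.ne)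
      refine h.mono le_rfl fun v => le_of_eq ?_
      simp only [lower]
      split_ifs <;> rfl
    refine hasMB_succ.2 ⟨a, a.2, by omega, b, hlt, hP _ _ hab, by omega, ih ?_⟩
    refine h.mono le_rfl fun v => le_of_eq ?_
    have hne := hab.ne
    unfold lower
    by_cases h1 : v = a <;> by_cases h2 : v = b <;> simp_all [Fin.ext_iff]

theorem hasM_of_hasMB {k P m : ℕ} {G : SimpleGraph (Fin k)} {w : ℕ → ℕ}
    (hP : ∀ a b : Fin k, bit P a b = true → G.Adj a b) (h : hasMB k P m w = true) :
    HasM G (fun i => w i) m := by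
  induction m generalizing w with
  | zero => exact HasM.zero _ _
  | succ m ih =>
    obtain ⟨a, ha, ha0, b, hb, hab, hb0, h⟩ := hasMB_succ.1 h
    refine hasM_succ.2 ⟨⟨a, ha⟩, ⟨b, hb.trans ha⟩, hP ⟨a, ha⟩ ⟨b, hb.trans ha⟩ hab,
      Nat.pos_of_ne_zero ha0, Nat.pos_of_ne_zero hb0, ?_⟩
    refine (ih h).mono le_rfl fun v => le_of_eq ?_
    unfold lower
    by_cases h1 : v.val = a
    · have h2 : v.val ≠ b := by omega
      simp [Fin.ext_iff, h1, show a ≠ b by omega]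
    · by_cases h2 : v.val = b <;> simp [Fin.ext_iff, h1, h2, show b ≠ a by omega]

/-- A test for the saturation condition at `v`, and for `δ` being at most the degree of `v`. -/
def condB (k t δ P : ℕ) (w : ℕ → ℕ) (v : ℕ) : Bool :=
  force (sumB k fun u => Bool.rec 0 (w u) (bit P v u)) fun d =>
    Bool.rec false (Bool.rec (hasMB k P (Nat.sub t d) fun u => Bool.rec (w u) 0 (bit P v u)) true
      (Nat.ble t d)) (Nat.ble δ d)

theorem condB_eq {k t δ P : ℕ} {w : ℕ → ℕ} {v : ℕ} : condB k t δ P w v = true ↔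
    δ ≤ ∑ u : Fin k, (if bit P v u = true then w u else 0) ∧
    hasMB k P (t - ∑ u : Fin k, if bit P v u = true then w u else 0)
      (fun u => if bit P v u = true then 0 else w u) = true := by
  have hrec' : ∀ (x y : ℕ) (z : Bool), (Bool.rec x y z : ℕ) = if z = true then y else x := by
    intro x y z; cases z <;> rfl
  unfold condB
  rw [force_eq, sumB_eq]
  simp only [hrec']
  set d := ∑ u : Fin k, if bit P v u = true then w u else 0
  cases h1 : Nat.ble δ d
  · have : ¬ δ ≤ d := fun h => by simp [Nat.ble_eq_true_of_le h] at h1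
    simp [this]
  · have h1 := Nat.le_of_ble_eq_true h1
    cases h2 : Nat.ble t d
    · simp only [h1, true_and]
      rfl
    · have h2 := Nat.le_of_ble_eq_true h2
      rw [Nat.sub_eq_zero_of_le h2]
      simp [h1]
      rfl

theorem condB_of_hasM {k t δ P : ℕ} {G : SimpleGraph (Fin k)} {w : ℕ → ℕ} {v : Fin k}
    (hP : ∀ a b, G.Adj a b → bit P a b = true) (hδ : δ ≤ wdeg G (fun i => w i) v)
    (h : HasM G (del G (fun i => w i) v) (t - wdeg G (fun i => w i) v)) :
    condB k t δ P w v = true := by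
  classical
  have hsum : ∑ x ∈ ({u : Fin k | bit P v u = true} : Finset (Fin k)), w x =
      ∑ u : Fin k, if bit P v u = true then w u else 0 := sum_filter _ _
  refine condB_eq.2 ⟨hδ.trans ?_, hasMB_of_hasM hP ?_⟩
  · rw [← hsum]
    refine sum_le_sum_of_subset fun u hu => ?_
    simp only [mem_filter, mem_univ, true_and] at hu ⊢
    exact hP _ _ hu
  · have h1 := hasM_zeroOn_of_del h ({u : Fin k | bit P v u = true} : Finset (Fin k))
      fun u hu => by simpa using hP _ _ hu
    rw [hsum] at h1
    refine h1.mono le_rfl fun u => le_of_eq ?_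
    simp [zeroOn]

theorem hasM_of_condB {k t δ P : ℕ} {G : SimpleGraph (Fin k)} {w : ℕ → ℕ} {v : Fin k}
    (hP : ∀ a b : Fin k, bit P a b = true ↔ G.Adj a b) (h : condB k t δ P w v = true) :
    HasM G (del G (fun i => w i) v) (t - wdeg G (fun i => w i) v) := by
  classical
  have h1 := hasM_of_hasMB (fun a b => (hP a b).1) (condB_eq.1 h).2
  have h2 : ∑ u : Fin k, (if bit P v u = true then w u else 0) = wdeg G (fun i => w i) v := by
    rw [wdeg, sum_filter]
    exact sum_congr rfl fun u _ => by simp only [hP]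
  rw [h2] at h1
  refine h1.mono le_rfl fun u => le_of_eq ?_
  simp only [del, hP]

end

/-! ### The search -/

noncomputable section

/-- A weighted graph given by its list of weights and its list of edges. -/
structure Pattern where
  weights : List ℕ
  edges : List (ℕ × ℕ)

/-- The octal digit of `s` at position `i`. -/
def octal (s i : ℕ) : ℕ := Nat.land (Nat.shiftRight s (Nat.mul 3 i)) 7

theorem octal_lt (s i : ℕ) : octal s i < 8 :=
  Nat.lt_succ_of_le Nat.and_le_right

/-- The octal digits of `s` are the images of the vertices of a copy of the pattern `p` in the
graph `P`. -/
def Pattern.check (p : Pattern) (k P : ℕ) (w : ℕ → ℕ) (s : ℕ) : Bool :=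
  Nat.beq p.weights.length k &&
  ((allB k fun i => force (octal s i) fun x => Nat.ble (Nat.succ x) k &&
    (Nat.beq (w x) (p.weights.getD i 0) && allB i fun j => !Nat.beq (octal s j) x)) &&
  p.edges.all fun e => bit P (octal s e.1) (octal s e.2))

/-- A copy of the pattern `p` spans the weighted graph `(G, w)`. -/
def Pattern.Spans (p : Pattern) {k : ℕ} (G : SimpleGraph (Fin k)) (w : ℕ → ℕ) : Prop :=
  p.weights.length = k ∧ ∃ f : Fin k → Fin k, f.Injective ∧
    (∀ i, w (f i) = p.weights.getD i 0) ∧ ∀ a b : Fin k, (a.val, b.val) ∈ p.edges → G.Adj (f a) (f b)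

theorem Pattern.spans_of_check {p : Pattern} {k P : ℕ} {w : ℕ → ℕ} {s : ℕ}
    {G : SimpleGraph (Fin k)} (hP : ∀ a b : Fin k, bit P a b = true → G.Adj a b)
    (h : p.check k P w s = true) : p.Spans G w := by
  simp only [check, Bool.and_eq_true, Nat.beq_eq, allB_eq_true, force_eq, Bool.not_eq_true',
    List.all_eq_true] at h
  obtain ⟨h1, h2, h3⟩ := h
  have hlt : ∀ i : Fin k, octal s i < k := fun i => Nat.le_of_ble_eq_true (h2 i i.2).1
  have hne : ∀ i j : Fin k, j < i → octal s i ≠ octal s j := by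
    intro i j hji heq
    have := (h2 i i.2).2.2 j hji
    rw [heq, Nat.beq_refl] at this
    exact Bool.noConfusion this
  refine ⟨h1, fun i => ⟨octal s i, hlt i⟩, fun i j hij => ?_, fun i => (h2 i i.2).2.1,
    fun a b hab => hP _ _ (h3 _ hab)⟩
  have hij : octal s i = octal s j := congr_arg Fin.val hij
  rcases lt_trichotomy i j with h | h | h
  · exact (hne j i h hij.symm).elim
  · exact h
  · exact (hne i j h hij).elim

/-- A search through the graphs between `P` and `Q` that are saturating and have minimum degree at
least `δ`, for copies of the patterns. The octal digits of `s` tell on which edge to branch, or at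
which vertex the graph `Q` violates the saturation condition, or how `P` contains a pattern; the
remaining digits are passed to `c`. -/
def search (pats : List Pattern) (k t δ : ℕ) (w : ℕ → ℕ) (n : ℕ) :
    ℕ → ℕ → ℕ → (ℕ → Bool) → Bool :=
  Nat.rec (fun _ _ _ _ => false) (fun _ ih P Q s c =>
    force (octal s 0) fun a => force (octal s 1) fun b => force (Nat.shiftRight s 6) fun s' =>
      Bool.rec
        (Bool.rec
          (force (edgeBits a b) fun e => force (Nat.lor P e) fun P' => force (Nat.xor Q e) fun Q' =>
            ih P' Q s' fun s'' => ih P Q' s'' c)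
          (Bool.rec false (Bool.rec (c s') false (condB k t δ Q w a)) (Nat.ble (Nat.succ a) k))
          (Nat.beq a b))
        (force (Nat.shiftRight s' 3) fun s'' =>
          Bool.rec false (force (Nat.shiftRight s'' (Nat.mul 3 k)) c)
            (match pats[Nat.add (Nat.mul 8 b) (octal s' 0)]? with
            | none => false
            | some p => p.check k P w s''))
        (Nat.beq a 7)) n

theorem search_succ {pats : List Pattern} {k t δ : ℕ} {w : ℕ → ℕ} {n P Q s : ℕ} {c : ℕ → Bool}
    (h : search pats k t δ w (n + 1) P Q s c = true) :
    (∃ p ∈ pats, ∃ s' s'', p.check k P w s' = true ∧ c s'' = true) ∨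
    (∃ v < k, condB k t δ Q w v = false ∧ ∃ s', c s' = true) ∨
    ∃ a < 8, ∃ b < 8, ∃ s', search pats k t δ w n (Nat.lor P (edgeBits a b)) Q s'
      (fun s'' => search pats k t δ w n P (Nat.xor Q (edgeBits a b)) s'' c) = true := by
  have hrec : ∀ x y z : Bool, (Bool.rec x y z : Bool) = if z = true then y else x := by
    intro x y z; cases z <;> rfl
  have h0 : search pats k t δ w (n + 1) P Q s c =
    force (octal s 0) fun a => force (octal s 1) fun b => force (Nat.shiftRight s 6) fun s' =>
      Bool.rec
        (Bool.rec
          (force (edgeBits a b) fun e => force (Nat.lor P e) fun P' => force (Nat.xor Q e) fun Q' =>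
            search pats k t δ w n P' Q s' fun s'' => search pats k t δ w n P Q' s'' c)
          (Bool.rec false (Bool.rec (c s') false (condB k t δ Q w a)) (Nat.ble (Nat.succ a) k))
          (Nat.beq a b))
        (force (Nat.shiftRight s' 3) fun s'' =>
          Bool.rec false (force (Nat.shiftRight s'' (Nat.mul 3 k)) c)
            (match pats[Nat.add (Nat.mul 8 b) (octal s' 0)]? with
            | none => false
            | some p => p.check k P w s''))
        (Nat.beq a 7) := rfl
  rw [h0] at h
  simp only [force_eq, hrec] at h
  split_ifs at h with h1 h2 h3 h4 h5
  · left
    revert h2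
    cases hp : pats[Nat.add (Nat.mul 8 (octal s 1)) (octal (Nat.shiftRight s 6) 0)]? with
    | none => exact fun h2 => Bool.noConfusion h2
    | some p =>
      exact fun h2 => ⟨p, List.mem_of_getElem? hp, _, _, h2, h⟩
  · exact Or.inr (Or.inl ⟨_, Nat.le_of_ble_eq_true h4, by simpa using h5, _, h⟩)
  · exact Or.inr (Or.inr ⟨_, octal_lt _ _, _, octal_lt _ _, _, h⟩)

theorem search_sound {pats : List Pattern} {k t δ : ℕ} {w : ℕ → ℕ} {G : SimpleGraph (Fin k)}
    (hk : k ≤ 8) (hw : ∀ i : Fin k, 0 < w i) (hG : Sat G (fun i => w i) t)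
    (hδ : ∀ i, δ ≤ wdeg G (fun i => w i) i) {n P Q s : ℕ} {c : ℕ → Bool}
    (h : search pats k t δ w n P Q s c = true) :
    ((∀ a b : Fin k, bit P a b = true → G.Adj a b) → (∀ a b, G.Adj a b → bit Q a b = true) →
      ∃ p ∈ pats, p.Spans G w) ∧ ∃ s', c s' = true := by
  induction n generalizing P Q s c with
  | zero => exact Bool.noConfusion h
  | succ n ih =>
    rcases search_succ h with ⟨p, hp, s', s'', hc, hc'⟩ | ⟨v, hv, hc, s', hc'⟩ |
      ⟨a, ha, b, hb, s', hc⟩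
    · exact ⟨fun hP _ => ⟨p, hp, Pattern.spans_of_check hP hc⟩, _, hc'⟩
    · refine ⟨fun _ hQ => ?_, _, hc'⟩
      have := condB_of_hasM (v := ⟨v, hv⟩) hQ (hδ _) (hG.2 ⟨v, hv⟩ (hw _))
      rw [hc] at this
      exact Bool.noConfusion this
    · obtain ⟨h1, s'', h2⟩ := ih hc
      obtain ⟨h3, h4⟩ := ih h2
      refine ⟨fun hP hQ => ?_, h4⟩
      have he : ∀ x y : Fin k, bit (edgeBits a b) x y = true ↔
          (x.val = a ∧ y.val = b) ∨ (x.val = b ∧ y.val = a) :=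
        fun x y => bit_edgeBits ha hb (y.2.trans_le hk)
      by_cases hab : ∃ x y : Fin k, x.val = a ∧ y.val = b ∧ G.Adj x y
      · refine h1 (fun x y hxy => ?_) hQ
        rw [bit_lor, Bool.or_eq_true, he] at hxy
        obtain ⟨x', y', rfl, rfl, hadj⟩ := hab
        rcases hxy with hxy | ⟨h5, h6⟩ | ⟨h5, h6⟩
        · exact hP x y hxy
        · rwa [Fin.ext h5, Fin.ext h6]
        · rw [Fin.ext h5, Fin.ext h6]
          exact hadj.symm
      · refine h3 hP fun x y hxy => ?_
        rw [bit_xor, hQ x y hxy, Bool.true_xor, Bool.not_eq_true', ← Bool.not_eq_true, he]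
        rintro (⟨h5, h6⟩ | ⟨h5, h6⟩)
        · exact hab ⟨x, y, h5, h6, hxy⟩
        · exact hab ⟨y, x, h6, h5, hxy.symm⟩

/-- The graph with the given edges. -/
def edgesBits (L : List (ℕ × ℕ)) : ℕ := L.foldr (fun e n => Nat.lor (edgeBits e.1 e.2) n) 0

theorem bit_edgesBits {L : List (ℕ × ℕ)} {c d : ℕ} (hd : d < 8)
    (hL : ∀ e ∈ L, e.1 < 8 ∧ e.2 < 8) :
    bit (edgesBits L) c d = true ↔ (c, d) ∈ L ∨ (d, c) ∈ L := by
  induction L with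
  | nil =>
    have : bit (edgesBits []) c d = false := by
      rw [bit_eq_testBit]
      exact Nat.zero_testBit _
    simp [this]
  | cons e L ih =>
    have : edgesBits (e :: L) = Nat.lor (edgeBits e.1 e.2) (edgesBits L) := rfl
    rw [this, bit_lor, Bool.or_eq_true, ih fun e he => hL e (List.mem_cons_of_mem _ he),
      bit_edgeBits (hL e (by simp)).1 (hL e (by simp)).2 hd]
    simp only [List.mem_cons, Prod.ext_iff]
    tauto

/-- The complete graph. -/
def fullBits (k : ℕ) : ℕ :=
  edgesBits ((List.range k).flatMap fun a => (List.range a).map fun b => (a, b))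

theorem bit_fullBits {k : ℕ} (hk : k ≤ 8) {a b : Fin k} (hab : a ≠ b) :
    bit (fullBits k) a b = true := by
  have hab : a.val ≠ b.val := fun h => hab (Fin.ext h)
  refine (bit_edgesBits (b.2.trans_le hk) ?_).2 ?_
  · simp only [List.mem_flatMap, List.mem_range, List.mem_map, forall_exists_index, and_imp]
    rintro e x hx y hy rfl
    exact ⟨by omega, by simp only; omega⟩
  · simp only [List.mem_flatMap, List.mem_range, List.mem_map, Prod.mk.injEq]
    have := a.2
    have := b.2
    rcases lt_or_gt_of_ne hab with h | h
    · exact Or.inr ⟨b, by omega, a, h, rfl, rfl⟩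
    · exact Or.inl ⟨a, by omega, b, h, rfl, rfl⟩

theorem exists_spans {pats : List Pattern} {k t δ : ℕ} {w : ℕ → ℕ} {G : SimpleGraph (Fin k)}
    (hk : k ≤ 8) (hw : ∀ i : Fin k, 0 < w i) (hG : Sat G (fun i => w i) t)
    (hδ : ∀ i, δ ≤ wdeg G (fun i => w i) i) {n s : ℕ} {L M : List (ℕ × ℕ)}
    (h : (force (edgesBits L) fun P => force (Nat.xor (fullBits k) (edgesBits M)) fun Q =>
      search pats k t δ w n P Q s fun _ => true) = true)
    (hL' : ∀ e ∈ L ++ M, e.1 < 8 ∧ e.2 < 8)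
    (hL : ∀ a b : Fin k, (a.val, b.val) ∈ L → G.Adj a b)
    (hM : ∀ a b : Fin k, (a.val, b.val) ∈ M → ¬ G.Adj a b) : ∃ p ∈ pats, p.Spans G w := by
  rw [force_eq, force_eq] at h
  refine (search_sound hk hw hG hδ h).1 (fun a b hab => ?_) fun a b hab => ?_
  · rcases (bit_edgesBits (b.2.trans_le hk) fun e he => hL' e (by simp [he])).1 hab with hab | hab
    · exact hL a b hab
    · exact (hL b a hab).symm
  · rw [bit_xor, bit_fullBits hk hab.ne, Bool.true_xor, Bool.not_eq_true', ← Bool.not_eq_true,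
      bit_edgesBits (b.2.trans_le hk) fun e he => hL' e (by simp [he])]
    rintro (h | h)
    · exact hM a b h hab
    · exact hM b a h hab.symm

end

noncomputable section

/-! ### Patterns and weighted graphs on arbitrary vertex sets -/

/-- The pattern `p` spans the weighted graph `Ω`. -/
def Pattern.SpansV (p : Pattern) (Ω : WeightedGraph V) : Prop :=
  ∃ f : Fin p.weights.length ≃ V, (∀ i, Ω.weight (f i) = p.weights.getD i 0) ∧
    ∀ a b : Fin p.weights.length, (a.val, b.val) ∈ p.edges → Ω.base.Adj (f a) (f b)

theorem Pattern.Spans.spansV {p : Pattern} {k : ℕ} {Ω : WeightedGraph V} (e : Fin k ≃ V)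
    {w : ℕ → ℕ} (hw : ∀ i : Fin k, w i = Ω.weight (e i)) (h : p.Spans (Ω.base.comap e) w) :
    p.SpansV Ω := by
  obtain ⟨rfl, f, hf, h1, h2⟩ := h
  refine ⟨(Equiv.ofBijective f (Finite.injective_iff_bijective.1 hf)).trans e, fun i => ?_,
    fun a b hab => h2 a b hab⟩
  rw [← h1 i, hw]
  rfl

/-- The pattern `p` describes the weighted graph `Θ`. -/
def Pattern.Represents {k : ℕ} (p : Pattern) (Θ : WeightedGraph (Fin k)) : Prop :=
  p.weights.length = k ∧ (∀ i, Θ.weight i = p.weights.getD i 0) ∧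
    ∀ a b : Fin k, Θ.base.Adj a b ↔ (a.val, b.val) ∈ p.edges ∨ (b.val, a.val) ∈ p.edges

theorem Pattern.Represents.isSpannedBy_iff {k : ℕ} {p : Pattern} {Θ : WeightedGraph (Fin k)}
    (h : p.Represents Θ) {Ω : WeightedGraph V} : Ω.IsSpannedBy Θ ↔ p.SpansV Ω := by
  obtain ⟨rfl, h1, h2⟩ := h
  refine exists_congr fun f => and_congr (by simp only [h1]) ⟨fun h a b hab => ?_,
    fun h a b hab => ?_⟩
  · exact h a b ((h2 a b).2 (Or.inl hab))
  · rcases (h2 a b).1 hab with hab | hab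
    · exact h a b hab
    · exact (h b a hab).symm

/-! ### Sorted lists of weights -/

/-- The non-increasing lists of at most `f` positive numbers that are at most `m` and have sum at
most `n`. -/
def descLists : ℕ → ℕ → ℕ → List (List ℕ)
  | 0, _, _ => [[]]
  | f + 1, n, m => [] :: (List.range (min n m)).flatMap fun x =>
      (descLists f (n - (x + 1)) (x + 1)).map fun l => (x + 1) :: l

theorem mem_descLists {f n m : ℕ} {l : List ℕ} (hf : l.length ≤ f) (hn : l.sum ≤ n)
    (hm : ∀ x ∈ l, 0 < x ∧ x ≤ m) (hl : l.Pairwise (· ≥ ·)) : l ∈ descLists f n m := by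
  induction f generalizing n m l with
  | zero =>
    rw [List.length_eq_zero_iff.1 (Nat.le_zero.1 hf)]
    exact List.mem_singleton.2 rfl
  | succ f ih =>
    cases l with
    | nil => exact List.mem_cons_self
    | cons x l =>
      rw [List.pairwise_cons] at hl
      rw [List.sum_cons] at hn
      have hx := hm x List.mem_cons_self
      refine List.mem_cons_of_mem _ (List.mem_flatMap.2 ⟨x - 1, ?_, List.mem_map.2 ⟨l, ih ?_ ?_ ?_ ?_, ?_⟩⟩)
      · rw [List.mem_range]; omega
      · simpa using hf
      · omega
      · intro y hy
        have := hl.1 y hy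
        have := (hm y (List.mem_cons_of_mem _ hy)).1
        omega
      · exact hl.2
      · congr 1; omega

theorem exists_sorted [Fintype V] (w : V → ℕ) : ∃ (l : List ℕ) (e : Fin l.length ≃ V),
    l.Pairwise (· ≥ ·) ∧ ∀ i : Fin l.length, l.getD i 0 = w (e i) := by
  classical
  set r : V → V → Prop := fun a b => w a ≥ w b
  have : Std.Total r := ⟨fun a b => le_total _ _⟩
  have : IsTrans V r := ⟨fun a b c h1 h2 => h2.trans h1⟩
  set L := (univ : Finset V).toList.insertionSort r
  have hperm : L.Perm (univ : Finset V).toList := List.perm_insertionSort r _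
  have hnodup : L.Nodup := hperm.nodup_iff.2 (nodup_toList _)
  have hmem : ∀ x, x ∈ L := fun x => hperm.mem_iff.2 (by simp)
  refine ⟨L.map w, (finCongr (by simp)).trans (hnodup.getEquivOfForallMemList L hmem), ?_, fun i => ?_⟩
  · exact List.pairwise_map.2 (List.pairwise_insertionSort r _)
  · rw [List.getD_eq_getElem _ _ i.2]
    simp

/-! ### The search for saturating weighted graphs of small weight -/

def lookup (tbl : List (List ℕ × ℕ)) (l : List ℕ) : ℕ :=
  tbl.foldr (fun e s => if e.1 = l then e.2 else s) 0

def searchFrom (pats : List Pattern) (t δ : ℕ) (l : List ℕ) (s : ℕ) (L M : List (ℕ × ℕ)) : Bool :=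
  force (edgesBits L) fun P => force (Nat.xor (fullBits l.length) (edgesBits M)) fun Q => force s fun s =>
    search pats l.length t δ (fun i => l.getD i 0) 22 P Q s fun _ => true

theorem exists_spansV_of_searchFrom [Fintype V] {Ω : WeightedGraph V} {pats : List Pattern}
    {t δ s : ℕ} {l : List ℕ} {L M : List (ℕ × ℕ)} (hΩ : Sat Ω.base Ω.weight t)
    (hδ : ∀ v, δ ≤ wdeg Ω.base Ω.weight v)
    (h : searchFrom pats t δ l s L M = true) (e : Fin l.length ≃ V)
    (hl : ∀ i : Fin l.length, l.getD i 0 = Ω.weight (e i)) (hk : l.length ≤ 8)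
    (hLM : ∀ e ∈ L ++ M, e.1 < 8 ∧ e.2 < 8)
    (hL : ∀ a b : Fin l.length, (a.val, b.val) ∈ L → Ω.base.Adj (e a) (e b))
    (hM : ∀ a b : Fin l.length, (a.val, b.val) ∈ M → ¬ Ω.base.Adj (e a) (e b)) :
    ∃ p ∈ pats, p.SpansV Ω := by
  have hw : (fun i : Fin l.length => l.getD i 0) = Ω.weight ∘ e := funext hl
  have hrange : ∀ v, v ∉ Set.range e.toEmbedding → Ω.weight v = 0 :=
    fun v hv => (hv ⟨e.symm v, by simp⟩).elim
  have hG : Sat (Ω.base.comap e) (fun i : Fin l.length => l.getD i 0) t := by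
    rw [hw]
    exact (sat_comap e.toEmbedding hrange t).2 hΩ
  have hδ' : ∀ i, δ ≤ wdeg (Ω.base.comap e) (fun i : Fin l.length => l.getD i 0) i := by
    intro i
    rw [hw]
    exact (hδ (e i)).trans (wdeg_comap e.toEmbedding hrange i).ge
  unfold searchFrom at h
  simp only [force_eq] at h
  obtain ⟨p, hp, h⟩ := exists_spans (w := fun i => l.getD i 0) hk
    (fun i => (Ω.weight_pos (e i)).trans_eq (hl i).symm) hG hδ'
    (by simpa only [force_eq] using h) hLM hL hM
  exact ⟨p, hp, h.spansV e hl⟩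

/-- If the searches for all lists of weights succeed, then the saturating weighted graphs are
spanned by the patterns. -/
theorem exists_spansV [Fintype V] {Ω : WeightedGraph V} {pats : List Pattern} {t m n k : ℕ}
    {tbl : List (List ℕ × ℕ)} (h : ∀ l ∈ descLists n n n, m ≤ l.sum → l.length ≤ k →
      searchFrom pats t 2 l (lookup tbl l) [] [] = true)
    (hΩ : Sat Ω.base Ω.weight t) (hm : m ≤ ∑ v, Ω.weight v) (hn : ∑ v, Ω.weight v ≤ n) (hn8 : n ≤ 8)
    (hk : Fintype.card V ≤ k) : ∃ p ∈ pats, p.SpansV Ω := by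
  obtain ⟨l, e, hl, hw⟩ := exists_sorted Ω.weight
  have hsum : l.sum = ∑ v, Ω.weight v := by
    rw [← Equiv.sum_comp e, ← Fin.sum_univ_getElem l]
    refine sum_congr rfl fun i _ => ?_
    rw [← hw i, List.getD_eq_getElem _ _ i.2]
  have hcard : l.length = Fintype.card V := by rw [← Fintype.card_congr e, Fintype.card_fin]
  have hpos : ∀ x ∈ l, 0 < x := by
    intro x hx
    obtain ⟨i, hi, rfl⟩ := List.mem_iff_getElem.1 hx
    have := hw ⟨i, hi⟩
    rw [List.getD_eq_getElem _ _ hi] at this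
    rw [this]
    exact Ω.weight_pos _
  have hlen : l.length ≤ l.sum := by
    rw [hcard, hsum, ← Finset.card_univ, Finset.card_eq_sum_ones]
    exact sum_le_sum fun v _ => Ω.weight_pos v
  refine exists_spansV_of_searchFrom hΩ (fun v => hΩ.two_le_wdeg (Ω.weight_pos v))
    (h l (mem_descLists (by omega) (by omega) (fun x hx => ⟨hpos x hx, ?_⟩) hl) (by omega)
      (by omega)) e hw (by omega) (by simp) (by simp) (by simp)
  have := List.le_sum_of_mem hx
  omega

set_option maxRecDepth 100000

/-- The weighted graphs that span the `4`-saturating weighted graphs of total weight at most `7`. -/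
def patterns4 : List Pattern := [
  ⟨[1, 1, 1, 1, 1], [(0, 1), (0, 2), (0, 3), (0, 4), (1, 2), (1, 3), (1, 4), (2, 3), (2, 4), (3,
    4)]⟩,
  ⟨[1, 1, 1, 1, 1, 1], [(0, 1), (1, 2), (2, 3), (3, 4), (4, 0), (5, 0), (5, 1), (5, 2), (5, 3),
    (5, 4)]⟩,
  ⟨[1, 1, 1, 1, 1, 1], [(0, 2), (0, 3), (1, 2), (1, 3), (2, 3), (0, 4), (0, 5), (1, 4), (1, 5),
    (4, 5)]⟩,
  ⟨[1, 1, 1, 1, 1, 1], [(0, 1), (1, 2), (0, 2), (3, 4), (4, 5), (3, 5), (0, 3), (1, 4), (2, 5)]⟩,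
  ⟨[1, 1, 1, 1, 1, 1, 1], [(0, 1), (0, 2), (1, 2), (3, 4), (3, 5), (3, 6), (4, 5), (4, 6), (5,
    6)]⟩,
  ⟨[1, 1, 1, 1, 1, 1, 1], [(0, 1), (1, 2), (2, 3), (3, 4), (4, 5), (5, 6), (6, 0)]⟩,
  ⟨[1, 1, 1, 1, 1, 1, 1], [(0, 1), (0, 2), (1, 2), (0, 3), (3, 4), (4, 5), (5, 6), (6, 0)]⟩,
  ⟨[1, 1, 1, 1, 1, 1, 1], [(0, 1), (1, 2), (2, 3), (3, 4), (4, 0), (2, 5), (5, 6), (6, 0)]⟩,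
  ⟨[1, 1, 1, 1, 1, 1, 1], [(0, 1), (0, 2), (1, 2), (0, 3), (0, 4), (3, 4), (0, 5), (0, 6), (5,
    6)]⟩,
  ⟨[1, 1, 1, 1, 1, 1, 1], [(0, 1), (0, 2), (1, 2), (2, 3), (3, 4), (4, 5), (4, 6), (5, 6)]⟩,
  ⟨[2, 2, 2], [(0, 1), (0, 2), (1, 2)]⟩,
  ⟨[3, 2, 2], [(0, 1), (0, 2), (1, 2)]⟩,
  ⟨[3, 3, 1], [(0, 1), (0, 2), (1, 2)]⟩,
  ⟨[3, 2, 1, 1], [(0, 1), (0, 2), (1, 2), (0, 3)]⟩,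
  ⟨[3, 1, 1, 2], [(0, 1), (0, 2), (1, 2), (0, 3)]⟩,
  ⟨[2, 2, 2, 1], [(0, 1), (0, 2), (1, 2), (0, 3)]⟩,
  ⟨[2, 1, 1, 2, 1], [(0, 1), (0, 2), (1, 2), (0, 3), (3, 4)]⟩,
  ⟨[2, 2, 1, 1, 1], [(0, 1), (0, 2), (1, 2), (0, 3), (1, 4)]⟩,
  ⟨[3, 1, 1, 1, 1], [(0, 1), (0, 2), (1, 2), (0, 3), (0, 4)]⟩,
  ⟨[2, 2, 1, 1], [(0, 1), (0, 2), (1, 2), (0, 3), (1, 3)]⟩,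
  ⟨[2, 1, 1, 1, 1], [(0, 1), (0, 2), (1, 2), (0, 3), (0, 4), (3, 4)]⟩,
  ⟨[2, 2, 1, 1, 1], [(0, 1), (0, 2), (1, 2), (0, 3), (0, 4), (3, 4)]⟩,
  ⟨[1, 2, 2, 1, 1], [(0, 1), (0, 2), (1, 2), (0, 3), (0, 4), (3, 4)]⟩,
  ⟨[2, 1, 1, 1, 1, 1], [(0, 1), (0, 2), (1, 2), (0, 3), (0, 4), (3, 4), (0, 5)]⟩,
  ⟨[1, 2, 1, 1, 1, 1], [(0, 1), (0, 2), (1, 2), (0, 3), (0, 4), (3, 4), (1, 5)]⟩,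
  ⟨[2, 1, 1, 1, 1, 1], [(0, 1), (0, 2), (1, 2), (0, 3), (3, 4), (3, 5), (4, 5)]⟩,
  ⟨[2, 2, 1, 1, 1], [(0, 1), (1, 2), (2, 3), (3, 4), (4, 0)]⟩,
  ⟨[2, 1, 1, 1, 1, 1], [(0, 1), (1, 2), (2, 3), (3, 4), (4, 0), (0, 5)]⟩,
  ⟨[2, 1, 1, 1, 1, 1], [(0, 1), (0, 2), (1, 2), (0, 3), (3, 4), (4, 5), (5, 0)]⟩]

/-- The weighted graphs that span the `3`-saturating weighted graphs of total weight `5`. -/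
def patterns3 : List Pattern := [
  ⟨[1, 1, 1, 1, 1], [(0, 1), (1, 2), (2, 3), (3, 4), (4, 0)]⟩,
  ⟨[1, 1, 1, 1, 1], [(0, 1), (0, 2), (1, 2), (0, 3), (0, 4), (3, 4)]⟩,
  ⟨[2, 2, 1], [(0, 1), (0, 2), (1, 2)]⟩,
  ⟨[2, 1, 1, 1], [(0, 1), (0, 2), (1, 2), (0, 3)]⟩]

/-- The weighted graph that spans the `2`-saturating weighted graphs of total weight `3`. -/
def patterns2 : List Pattern := [
  ⟨[1, 1, 1], [(0, 1), (0, 2), (1, 2)]⟩]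

/-- For each list of weights, a certificate of the search for `4`-saturating weighted graphs with
these weights: octal digits that choose the branches. -/
def table4 : List (List ℕ × ℕ) := [
  ([1, 1, 1, 1, 1, 1], 0x6db6c00009242498c8a90e8d362925a4aae1047455715218e6a84a5538411ea715218f152e54431d1b21a1024901249a22c43c555095b13a411e5715218e2c4ea8431ea421a40b49b6b22243ab0cb6c8a3a411d4754218e62aec4431e5a502644ac68823d4ec4431c2b1a94863a94da935290c7892715218ea046a52b4411e272a218e14ad58431ea86846022b8d3000000b6d6e492b8114398a2722463a811ca754218ed18e98831d48cd55b492b6b421439b114913156411e174c418f4c55c4431ca563b49914ac823a95c4431dc46b50863c2aa44d6a10c786a90cad02398ec4431dc2ab31063a86a72ba440800001248924dc685287acaa92b4d8d0239ae54431dd2a335063d49996380496da91ae204729c54863b46baddb1d08a1cd4dc35063d6a98e00da44d519047a5c35063c3547510c72abb49563208e8c66a0c7855263a8863944ab1904746335063c2abb1aa431cd4dcb142100006ed492b5aa2143ca5446db2246a7011ca31394863a86a44ca9904785394863d31266c0c72a5aa34929246a0a50f6192266c0c7b1ab086398e545244c9626411ec4e5218ee529d8431e1a8968d818f2c8d1b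031ec6a5218ee5369ad404735a36063ca9d8431d584a8ab6886dbb6d2498cd418e0c24b34448785336063828caada913296811e18d5218e0c45ab031ca96424b56063a24a66c0c7441b0b95063984aa5c04744b95063c29ca431c18953538db49224974c418e0d24b86a0c705942c43d30d5125213632811e9ae2218e0d8cca831cca89263a8863ca4d7110c7b1506d959408f2b32a0c756166c418e6c45464924c9622c21dc68d818ea580a3248496ac0c745cb0992b31063d9152c21dc064660a90f633620c771152991226a8584382cca831d15522e5418ea9ae244d85a047a6b5086383532ac0c72acb49655818e54a4aacc047453b086382a97620c7a54313ad08282c92492649124adb6c458438aeb41256872a24716b88863ba15ae54411dd4cd818e2b5508e496dadd8ca0874c556d483b112384d1b031da16a8c863ab5896da055190c782c21a43a0eab6a4ec4411da8ea218e13b156431d515c525641449249492b6492daa1610ee88e0b6c8254c91c48cd418ee0b2356104772b5086388ed81356da94822ac91c470d418ee0523aa1047713b086388d0aea405b5111a1dd814ac863d0d5add4cc0878d4ac863a62d8990c774296255906db6d25b900561608e829590c721445d818e226042ea0c708085d418e845590c72144a545823c50ba831c245d818ed091b328aadb6c9224488ea24705995063b2112ea3011d96ac218e0b4e084c8043434874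1c465618f0332375c2821d3465618e588a1ac31dc05454524001249195863c55248d11a1e245d818f535048932ac0c74c449d85023b50ba831ea72155863a880acda924dc2ab0c72eb46043c6144948256891c472a218ee0511ac31e268549b023a8823c0a1ac31e88c0aa3218f044c5287a0b88002235863c5454e10c781a91b4ec208e9d8990c72d44aa70863a6956a10c74cb6d3b0823a7626431cb504b1a218f1a0a832ba8c2924925248ddb634421c52e98d063ba60921368b1a24715d88863ba0dae52811dd2d5818e2b225a058832872298d063c0ec35a0c714c72c29a092480b6490974a808ecb5290c705c100922a1943b84152b0c780c74091b362608e5c46b0c7acc89d218ee10d93294c11e189d218e0c64952b0c784994a608f0c4e90c7063aca76063b304a2b455b6a44c9213152c21d911c0499056a12388e2a431dc06474c408ee17620c711985a9242457112382cd8831d911c91b2a5618e9d7110872c4315618ee1850aeda936492d53021e104986b418f0c4e90c70518e4245899238253b031d110900b56063c08c6a90c705c32b418e616d0a9124c8d4a411dcacc418e2320920195a0c7a2942343c0cd85a0c706168902971063c0c80dc74a0478e971063974c6831d381b858a90e9c2ab0c72cc55863c74432365d8811cbb0b418e9984d2e20c72c9acc418e5a6d97620472ec2d063a66092b4431dc0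4a7650a29249004806eb85023d70ba831cba1b2e5408e5d8d10c7ac8280261ad063a30a15a1d9a252d06390d21618e249124b72350d087b2bb454e1238b296831e5754218eeb80c96b86a04774b950638ae1b1a0c7b1984269249b2648d1a10f6026a8c31e1ae4b63a88438a6a8c31dd32951863d85c614921202305687a2951863a0cd4630c705cb246c0b0a608f454e10c72298d063a1580654c11c845d818f41b1a0c740bb00b6962243ca6a8c31dd42daa0650eed4630c79482ac618e2b8634508000013236dc2c5487ad3b1b54c608e998ab0c7adc4646eb31023d6656831d3b0c75063b8c9885005a492db74b1121e34d18496d4a5823a74a8c31e345b8cd408f19b1a0c74e16652496d435823a66a8c31e3461264a60690ee52e20c7b1135c418f0b2ea0492db6558c31e34db2a5618e9a2c58878eb8512406cc75063c6dc66a0478cd8d063a729ae20c775085b6ca76063ca9c9622c11ec465618e6568d8c31e3459a209246db48c55823946b8831c22eb6d570863d69886484b6944cd0870aa8c863955964ab190c72d311b6d202262943d062ac11e02ac4c863845d6d80ac6431e052b218f458c228740b02b50823d0ab8431e0b0b418e8569996244c8018ea0c7a0cb45519238ae98831dd1254c863d8c84dda054c42878254c863a12c86a8c11cc46c618e245590c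7b052c054c618f048a1ac31cc54c618e20a05711047a2568863a0a98c31e096b2800094e5208e8ca990c76652d063c36216931aa411e1563218ecd4630c746525c54823b2ab8431e154c618e8bb0484c4e90c746222b43b36129ca431d98e9410e888a3a431e1a138c8895343),
  ([2, 1, 1, 1, 1, 1], 0x912dd45881f8e1b1161be592d1a207e1b1161beccae95037cd26c4586fb28cac17e174a81bf4bb112db460a1fb1d2a06fa94ba8c0df84988b143f4ba8c0df86b25d4606fc28d8c17e98e54586fb35132546061f72c4586fa911a187dd95161beaa2ec05f959b0a61bf0ca530dfa5a458a2000002d6c974c083e8a8e1a837e12652c20fa2e1a837e14c970d41bf0d2a305f4638cd41be5aa4a5294187da8cd41bf5331d2837d12553030fb31d2837d1709a5c40becc74a0df45450d61bf0ba4a4a96207e350d61bf5ba5081f89c3506fd54c6817d385ca506fa2a52c37d99698180009122543430fb2eaa630dfa49b0a0c3ecaa630dfa5aae141be5135c2837d185d40becaa630dfa557094942c50fd6a98c37e370a143f5435a05f6a956161becbb0a0df46c25bb0b083e9d70a0df8dc3420faaec2837e585560beea2e98837e9acc41beca90b00364a5594207e24cd103f2b32a05faa1b1941be8aa5c0df3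63264acc083ea58ca0df7233420faacab017e546c2d06fc3296837e94c94933050fd8a97037dc8ca143f54a5a0df699b102fa94aacc0df8656506fa3596492956620df8ac2d06fb4ac2c37e555981beec2ea11f56164992c4586fa9632837dc95161beacaca0df7595608fcaca55c2837dc6ea2c40fc7598837cb8ac2986fb4ec2837e575181beac2ab11f761449494a586fd8a97037dc94b41bed466a0dfaa97108fa8ca4a1ac37eb4943586fd6ac2c37ec2d53186fb8e1a837ea74c41bf1531a11f6a149d2a06fa9294c37d34a52d06fb49585a0df68cb1161bea174a8c47dc6e52c20fa719a837cb74c083ea386a0df3295182fc6ac74a0df75ca506fca8d2c41420924036049622c37c4b13043e6065815c4437c38c091c5410f98e95037c40c0ae221be1c6680ec4437c39450009223588f895c4437dc88d60be60a03b110dfa0076221bf441287595124000ddb2a6087cd95161be2971d4437ebb5d4606f8aea8087cd8ea21bee996d46311f163a886fbb518c17cd71ca886fd8c405004c801898a1fa2c31561be2576806a6207e094d5186f8a018ab0df100353103f04a6a8c37e87630c0b5d5086f8a03a8881f81d5086fd128600062ac37e075421be280626287e8751103f04a1d7080048e22287ec75421be650e2a437e00c001c5486fc06a8c37e80e3a4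002475421be61aa30df722ac82fd943005b546447c531561beeb8a90df36a8c82fcac40580048ec4437ec75421be657110df8e8b4975421bf08ae54437e571521bf4da6a6207e5ae221be2d46305f363b6c4586f8b2a6087cdaa320bf2971d4437eb8182a2a800009093150c3ee9aa30df56c4430fb35c4437d189d20bf4b95a8437cc50036261bf158c500016926a8187dc31561bea4a8861f663a886fa3538417cc7635486f9a654c37e5a984a46e52986f871aa087cb3656886fbadd8530df0eb5010f972b4437eb31b68d823e1cad10dfada3602f97658d10df70a6c9ad421bf0935a8437cc44326b4440fc3634437d18ec4c86fb2d96a881f8cd8986f87626437cb95b89d223e1d8990df2da9482fc669ad40df76224d4e06fb84d8d10df7116ea7088f866a7037e38654c86f96dc6a90df0e54c86f966a7037e33498d1143f4cad10df4654c86fb26a7037dc35a81bea356105f31d6cb5050fd6654c37c335381bf1ca990df2e5aa881ab6d0006e33506f971aa437d370d41be638a90df5153188fb8c40a9b680936ab8087cb50d61be198200a3a437c47006e3a506f872b4087cb10051d21be23850113a437c40227486f88044e90df10c71a01b74c423e1c4e90df4eb3102f96a3a437e382234025b8ea21be1cac841f4d18ab21bec880366b8107d331561be1c5590df2c45006dd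5088f875a8417d38ab21be58803662ac37c335c083e9c5590df2c450c00c7506fc0e004c4e90df69b8ea21be1cac841f4d18ab21be588036ab8087cb70d41be1d6a105f4c43006dc5486f866b8107d3acc40be588036ab8087cb71521be19ae041f4c43140147486f88e1aabb680948ac6087cc52961be2169ca437e391ca506f88ec4087cc4e521bee14d4a437e29252d08f88d4a437d44e521bee585a05f31a60d00991ca886f88ec2107d445ab086fc3219530df10d8c20fa8d58437cc4c3024953223e235610df32c4c82fa818121b1841f50ca986f88d58437cc0d32c02e541bec460484b9510df2846a521bea35610df864363083ea46a90df12c2d02f989c8ac6087cc8cd41be2589905f50b4e521bf1b06aa04849b1061f68b9506fd4ac2187d94e521bf4d8d105f29c4ec21be617620df518254ac86fb24a8e90dfa54ac86fb2e369d8437c3559103f1a9590df2cc6cbb106f866b4207e352b21be5c4498ea0df70951d21bee52db5610df0d56440fc70c5590df65b35a103f197620df0e2ac86f97154dcad111f0d4ac86f975c4417e328cad06fb503b2c8db694a991d7a832e42654c86fb2ab71aa475c394b41be59a992dcad11d70e56886fa68932b2837d16496e5688eb872b2107d3462ac86fb2ab64cad11d74434a56810f95194287ea2e27486fb46ba2484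b66c6875c332b41bf5a64b71aa475c389d21bf5a74b6ec4475c36e5688eb875b6ec4475c395a21bf5a68b6ac6475c352b21bf5a66c11f4d912c91b25c548ebd21b64c6a91d7a434db35c43ae19ad40df4eb6ec4c8eb87626437d3acc423f5962004b5290dfa5d8886fa21806c4c37c34c02ec41be1805d8837c34eb02c4c88fb0592d9b1a1d70d36cd710eb86656837d3adb76223ae1b6ec4475c34db95a23ae1cad10df4eb45b71523ae1b6e2a475c3adb8d523ae1c4e90dfad3a5bb1323ae1d8990df4d4ac86fd6c896284c8d98ea1d70cd4e06fa62366a8c37c331d083e9a8a926b8837e290c7506f886b8837d455d24d8d06fa649b1a0df68d7106fc4eb65ca837c331a143f59b1a0df4d5b1b914748eb889ca437ec715223ea07228c8a1fb147486f886b8837d4ae48d5223e21b1a0dfb235482fa89d24ab190dfb0956321bf2b52466a11f1158c86fd9555190df52454b81be22b190dfb2a8c86fa94b3237634475c3b1941be5d8d10df4eb8888fd6237632107d3ae221be1d5190df2cd7106fd6a37634447c38ea20bf5ab190df2cd8d06fa7622e36da5634087caaa321bf128e821f3558c86fcb19a817d52e36c055981be200a56437c4b0055981be200a56437c4b142d5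7086fc7581538437e36ec2d06f97538437e3ad4223f5c0993256a11d712a7086fb8d135a8437da89292b508eb89614187dc6ab3106fc4ca55c2837dc92b508eb89538437dc69bb13043e5d85841f4eb8886fc712292a630df8d2ae141bee15256a11d712a7086fb8d3a620df88d2558586fb2ec2837ca26b3106f96ec4437ca8ac2d08fa692b1821f2d39486fc6ec4087ca6a521bf1585a05f68d96455c23ae22ae10df713b086fd8a1ac47d476475423ae23aa10df51ab086fd8e1a847dc558868408),
  ([1, 1, 1, 1, 1], 0x1b2494802404808d10070a221981a311718),
  ([2, 2, 2], 0x90004423d020a),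
  ([2, 2, 1, 1], 0x480012034435c82c340a),
  ([2, 1, 1, 1, 1], 0x242634445d17126a11176926a11174e34445e328c2496a11174e16c96a11178538d11178d18991172d4102043),
  ([3, 3, 1], 0x94443ca042),
  ([3, 2, 2], 0x90004433c1411),
  ([3, 2, 1, 1], 0x496863d34c8a7b2d114f443088),
  ([3, 1, 1, 1, 1], 0x98990976616825da8d109729a8425cc4630977198825e2210818),
  ([2, 2, 2, 1], 0x12db4473c3681e796c85cf4d1210),
  ([2, 2, 1, 1, 1], 0x6c981a21729281a21728c89909f50b4896889978626427d98a34427ca8d381b00971105729a8415cc6620178a000981a2174598805d46a10573204cb6c99232165d48d109f1114e109f85390971105744451909f5108c85e12e34082402644998805c289909f6844a221e5da51909f09c8816522408990570590920216805c109a0122626415cb09a8427da06284026446301711c4427d48c190051905704490071109f21c0146415c11146400138415e08d10570804e10578216805c26988885d4061298)]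

/-- The certificates of the search for `3`-saturating weighted graphs. -/
def table3 : List (List ℕ × ℕ) := [
  ([2, 2, 1], 0x94421d1042),
  ([2, 1, 1, 1], 0x4b4431ca2d063a6990c72d0203),
  ([1, 1, 1, 1, 1], 0x249006d20226091c82998801c22c02616111d16620076506a10072130cc51b6c92526a104709a8401e20614c01d13034db4922626411c166200784288b0072a20e42406604474222c01d84626401c15120226401c88806a02472214c01d82a16801c23132c42490120194211e06620076220214191d885a00781a4198492520222191d889900781a5190070a26524895190072e209201a2211e06a10076224e100709a8410000234401da8080008ca0072e06e48c84475138401cc8d10071139234091cc8ca0071146401d42c84120094606476614c01e18d10070446802516211e188b00766071100722290071100721470a0073098d10470632801d970a007860083463)]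

/-- The certificates of the search for `2`-saturating weighted graphs. -/
def table2 : List (List ℕ × ℕ) := [
  ([1, 1, 1], 0x94401d1042)]

theorem searchFrom_table4 : ∀ l ∈ descLists 7 7 7, 1 ≤ l.sum → l.length ≤ 6 →
    searchFrom patterns4 4 2 l (lookup table4 l) [] [] = true := by
  decide +kernel

theorem searchFrom_table3 : ∀ l ∈ descLists 5 5 5, 5 ≤ l.sum → l.length ≤ 5 →
    searchFrom patterns3 3 2 l (lookup table3 l) [] [] = true := by
  decide +kernel

theorem searchFrom_table2 : ∀ l ∈ descLists 3 3 3, 3 ≤ l.sum → l.length ≤ 3 →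
    searchFrom patterns2 2 2 l (lookup table2 l) [] [] = true := by
  decide +kernel

theorem searchFrom_minDegree_two : searchFrom patterns4 4 2 [1, 1, 1, 1, 1, 1, 1]
    0x249096f58c85874e3b9104fadbce52161d5d632161d3b1e4413ddcd16f2063b87adc06e5c74d6729147ce95ac6451d959b48959ca451e9c9bce540e1cd2958f1147ab34b58d038729c0ae3c7a96b19147c8b4b10a3b87a89c818ee1e95ac6451d9c428ee1eaca3b8a04f2ab4e5c451d33acd9b26dd632103d5d632161e5475223587a5327570858746306e5c7a6bb63235587556b1914797505c5c776e7103c7359589b6e70858755bb9c2161d59732161d397571104f751b6207578776e05c5c7554b9914795951ea451e979b6d47a914735b51ea451cd9630755c7573b5c4353873750a33c79757103c754bb6e22358757521464f35397114795351dc451eb394b5b253971147c758d104f4534990b5987896b19147cb58ca04f289642d661e25ac6451f24e5c451f1d634413d16999492494ecc451ec6947711478b1489253b31147c6c6895ac6451ec256b19147971c94d5914789991b9ab2161d35356451cbd5c2161d651dc451ced5c4413de51bae64413d6ae62813ced634413d3d632813cbd634441f39517496ea063d87cd5731147adc0755c74f16ee8c85874dbd1d2161d655cc451ceba32161d3ae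3d5104fcd15746451d955b48955cc451cea9bd1d40e1ce29b51dc451ce8968e9147cab4a90a3d87c89a428f61f2a818f61f1a947a91478a3d4a04f2b34ae8d03872ae0a33c789c0b53c7c95d19147a8b4e6a451d33746f64add634083cdd6340e1e52ad710d4e1cdd428cf1e58b5423387a8e4adba340e1cdd632813e52ad642d661e5b828cf1cd895d19147aa6b6e42338737540c64f556b191479562f64b57103872947711478a30ae3c7a8e48951dc451ce5356451cb89b9ab40e1cbd5c40e1ce29b5746451cb55cc451ceaa65ab8451d6af6b6343538737509c3c77758d03c755397114794eb5c23558756e8d03c7356ae11477750635c7956b5a0759879539a9147353ba114776e0635c75664ed4ae7103872947a91478a30b53c7cae09c3c768d48951ea451cd52e6451cb89bb9c40e1cd97340e1cb29b59ca451cd5ac6451cbc93d611476a54a10b57876b570a04f289881d5e1d951dc451f151ea451e9842d5e1dad5c4413ca896ae1147c9d5738451d5ccc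
    [(0, 1), (0, 2), (3, 4), (5, 6)] [(0, 3), (0, 4), (0, 5), (0, 6)] = true := by
  decide +kernel

theorem searchFrom_minDegree_three : searchFrom patterns4 4 3 [1, 1, 1, 1, 1, 1, 1]
    0x36daddad49ab3114769e951147294af114789dc55493d2914769e94a14729e3621c788d7a6b766d9b321472d63631c78e6924b5e56114757431e52914751672914771e376924761c851cc71d8b114750e24991d8b11475168e9147729c5695914765d9911474567611c78667569366d9d621472da9711474ce9097ac4451d1b5eaa1147554af114774e85e5291c7a54b9914765e51b48959d8471e1c8925b533a451f3869754c471f18b4ac224f2ab249d614c13e146cc4344fc74a4344fa53492688d641ca6b588324f8b4a8324faacc8324fc8bd36252254b991476625738451ea8524b64f4a451e6a9a51ea451e2a76d630893e629e492715c451ea89397114769cb8a14728e249b5cab1147556ae1147761c567291c7a56b1914765cb9114745672e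
    [(0, 1), (0, 2), (0, 3), (4, 5)] [(0, 4), (0, 5), (0, 6)] = true := by
  decide +kernel

theorem searchFrom_minDegree_four : searchFrom patterns4 4 4 [1, 1, 1, 1, 1, 1, 1]
    0x2ddaddadda4794a451d48f2a451dc3955a57ad6f69952c51d62ed6d59991472e66a91474e5cd598ddb64ad74e8851cd8b64a67511472a2af114789ea8e9b626d9956451d567626674a147461af214785ea66b648eac451dcb647568451cc732a451dc3745766d69591472e56b11474e6b4995e4451d17958451e156459d8451cc59ca451dc8b3a451e235e94e59db52d899734451d17a5c5a187c5a25b7728461ebb56761147773865c991876729496c96e1cea147cccad5c631878f193685ea851de9232355077163368ae2c51ce8ae6451de526a9918799955b4b65718c61cea96a63187ca3da49716861ecda35a914759c3a6a5a1879939127aa8461ea86e6851da3128f52851ca5a98c61f271ea6218751ea6e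
    [(0, 1), (0, 2), (0, 3), (0, 4)] [] = true := by
  decide +kernel

end

/-! ### Simple graphs on seven vertices -/

theorem exists_spansV_of_injective [Fintype V] {Ω : WeightedGraph V} {δ s : ℕ} {L M : List (ℕ × ℕ)}
    (hΩ : Sat Ω.base Ω.weight 4) (h1 : ∀ v, Ω.weight v = 1) (hc : Fintype.card V = 7)
    (hδ : ∀ v, δ ≤ wdeg Ω.base Ω.weight v)
    (h : searchFrom patterns4 4 δ [1, 1, 1, 1, 1, 1, 1] s L M = true)
    (hLM : ∀ e ∈ L ++ M, e.1 < 8 ∧ e.2 < 8) {x : Fin 7 → V} (hx : x.Injective)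
    (hL : ∀ e ∈ L, ∀ (h1 : e.1 < 7) (h2 : e.2 < 7), Ω.base.Adj (x ⟨e.1, h1⟩) (x ⟨e.2, h2⟩))
    (hM : ∀ e ∈ M, ∀ (h1 : e.1 < 7) (h2 : e.2 < 7), ¬ Ω.base.Adj (x ⟨e.1, h1⟩) (x ⟨e.2, h2⟩)) :
    ∃ p ∈ patterns4, p.SpansV Ω := by
  have hb : x.Bijective := (Fintype.bijective_iff_injective_and_card x).2 ⟨hx, by simp [hc]⟩
  refine exists_spansV_of_searchFrom hΩ hδ h (Equiv.ofBijective x hb) (fun i => ?_) (by simp) hLM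
    (fun a b hab => hL _ hab a.2 b.2) fun a b hab => hM _ hab a.2 b.2
  rw [h1]
  revert i
  decide

theorem exists_spansV_of_card_seven [Fintype V] {Ω : WeightedGraph V}
    (hΩ : Sat Ω.base Ω.weight 4) (h1 : ∀ v, Ω.weight v = 1) (hc : Fintype.card V = 7) :
    ∃ p ∈ patterns4, p.SpansV Ω := by
  classical
  have : Nonempty V := Fintype.card_pos_iff.1 (by omega)
  have hw : ∀ v, wdeg Ω.base Ω.weight v = #{u | Ω.base.Adj v u} := fun v => by
    simp [wdeg, h1]
  have hout : ∀ s : Finset V, #s < 7 → ∃ x, x ∉ s := by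
    intro s hs
    by_contra! h
    have := card_le_card (fun x _ => h x : univ ⊆ s)
    rw [card_univ, hc] at this
    omega
  obtain ⟨v, -, hv⟩ := exists_min_image univ (fun v => wdeg Ω.base Ω.weight v) univ_nonempty
  have h2 := hΩ.two_le_wdeg (Ω.weight_pos v)
  have hdel := hΩ.2 v (Ω.weight_pos v)
  have hdel1 : ∀ u, 0 < del Ω.base Ω.weight v u → ¬ Ω.base.Adj v u := by
    intro u hu hadj
    simp [del, hadj] at hu
  rcases (by omega : wdeg Ω.base Ω.weight v = 2 ∨ wdeg Ω.base Ω.weight v = 3 ∨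
    4 ≤ wdeg Ω.base Ω.weight v) with hd | hd | hd
  · rw [hd] at hdel
    obtain ⟨p, q, hpq, hp, hq, h⟩ := hasM_succ.1 hdel
    obtain ⟨r, s, hrs, hr, hs, -⟩ := hasM_succ.1 h
    have hlow : ∀ u, 0 < lower (lower (del Ω.base Ω.weight v) p) q u →
        u ≠ p ∧ u ≠ q ∧ ¬ Ω.base.Adj v u := by
      intro u hu
      have hu' := hu.trans_le ((lower_le _ _ _).trans (lower_le _ _ _))
      have h3 : del Ω.base Ω.weight v u ≤ 1 := (del_le _ _ _ _).trans (h1 u).le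
      refine ⟨?_, ?_, hdel1 u hu'⟩
      · rintro rfl
        have := hu.trans_le (lower_le _ _ _)
        simp only [lower, if_true] at this
        omega
      · rintro rfl
        have h4 := lower_le (del Ω.base Ω.weight v) p u
        rw [lower, if_pos rfl] at hu
        omega
    have hp := hdel1 p hp
    have hq := hdel1 q hq
    obtain ⟨hrp, hrq, hr⟩ := hlow r hr
    obtain ⟨hsp, hsq, hs⟩ := hlow s hs
    rw [hw] at hd
    obtain ⟨a, b, hab, hN⟩ := card_eq_two.1 hd
    have hN' : ∀ x, Ω.base.Adj v x ↔ x = a ∨ x = b := fun x => by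
      simpa using Finset.ext_iff.1 hN x
    have ha : Ω.base.Adj v a := (hN' a).2 (by simp)
    have hb : Ω.base.Adj v b := (hN' b).2 (by simp)
    have hx : Function.Injective ![v, a, b, p, q, r, s] := by
      rw [← List.nodup_ofFn]
      have := hpq.ne
      have := hrs.ne
      have := ha.ne
      have := hb.ne
      have hne : ∀ y z, Ω.base.Adj y z → ¬ Ω.base.Adj v z → v ≠ y := by
        rintro y z h3 h4 rfl
        exact h4 h3
      have := hne p q hpq hq
      have := hne q p hpq.symm hp
      have := hne r s hrs hs
      have := hne s r hrs.symm hr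
      simp
      grind
    refine exists_spansV_of_injective hΩ h1 hc (fun u => hΩ.two_le_wdeg (Ω.weight_pos u))
      searchFrom_minDegree_two (by decide) hx ?_ ?_
    · simp only [List.forall_mem_cons]
      exact ⟨fun _ _ => ha, fun _ _ => hb, fun _ _ => hpq, fun _ _ => hrs, by simp⟩
    · simp only [List.forall_mem_cons]
      exact ⟨fun _ _ => hp, fun _ _ => hq, fun _ _ => hr, fun _ _ => hs, by simp⟩
  · rw [hd] at hdel
    obtain ⟨p, q, hpq, hp, hq, -⟩ := hasM_succ.1 hdel
    have hp := hdel1 p hp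
    have hq := hdel1 q hq
    have hδ : ∀ u, 3 ≤ wdeg Ω.base Ω.weight u := fun u => by
      have := hv u (mem_univ u)
      omega
    rw [hw] at hd
    obtain ⟨a, b, c, hab, hac, hbc, hN⟩ := card_eq_three.1 hd
    have hN' : ∀ x, Ω.base.Adj v x ↔ x = a ∨ x = b ∨ x = c := fun x => by
      simpa using Finset.ext_iff.1 hN x
    have ha : Ω.base.Adj v a := (hN' a).2 (by simp)
    have hb : Ω.base.Adj v b := (hN' b).2 (by simp)
    have hc' : Ω.base.Adj v c := (hN' c).2 (by simp)
    obtain ⟨r, hr⟩ := hout {v, a, b, c, p, q} (card_le_six.trans_lt (by omega))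
    simp only [mem_insert, mem_singleton, not_or] at hr
    have hx : Function.Injective ![v, a, b, c, p, q, r] := by
      rw [← List.nodup_ofFn]
      have := hpq.ne
      have := ha.ne
      have := hb.ne
      have := hc'.ne
      have hne : ∀ y z, Ω.base.Adj y z → ¬ Ω.base.Adj v z → v ≠ y := by
        rintro y z h3 h4 rfl
        exact h4 h3
      have := hne p q hpq hq
      have := hne q p hpq.symm hp
      simp
      grind
    refine exists_spansV_of_injective hΩ h1 hc hδ searchFrom_minDegree_three (by decide) hx ?_ ?_
    · simp only [List.forall_mem_cons]
      exact ⟨fun _ _ => ha, fun _ _ => hb, fun _ _ => hc', fun _ _ => hpq, by simp⟩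
    · simp only [List.forall_mem_cons]
      refine ⟨fun _ _ => hp, fun _ _ => hq, fun _ _ h => ?_, by simp⟩
      rcases (hN' r).1 h with h | h | h
      · exact hr.2.1 h
      · exact hr.2.2.1 h
      · exact hr.2.2.2.1 h
  · have hδ : ∀ u, 4 ≤ wdeg Ω.base Ω.weight u := fun u => hd.trans (hv u (mem_univ u))
    rw [hw] at hd
    obtain ⟨S, hS, hScard⟩ := exists_subset_card_eq hd
    obtain ⟨a, S, haS, rfl, hS3⟩ := card_eq_succ.1 hScard
    obtain ⟨b, c, d, hbc, hbd, hcd, rfl⟩ := card_eq_three.1 hS3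
    have hS' : ∀ x, x = a ∨ x = b ∨ x = c ∨ x = d → Ω.base.Adj v x := fun x hx => by
      simpa using hS (by simpa using hx)
    have ha := hS' a (by simp)
    have hb := hS' b (by simp)
    have hc' := hS' c (by simp)
    have hd' := hS' d (by simp)
    obtain ⟨p, hp⟩ := hout {v, a, b, c, d} (card_le_five.trans_lt (by omega))
    obtain ⟨q, hq⟩ := hout {v, a, b, c, d, p} (card_le_six.trans_lt (by omega))
    simp only [mem_insert, mem_singleton, not_or] at hp hq haS
    have hx : Function.Injective ![v, a, b, c, d, p, q] := by
      rw [← List.nodup_ofFn]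
      have := ha.ne
      have := hb.ne
      have := hc'.ne
      have := hd'.ne
      simp
      grind
    refine exists_spansV_of_injective hΩ h1 hc hδ searchFrom_minDegree_four (by decide) hx ?_ (by simp)
    simp only [List.forall_mem_cons]
    exact ⟨fun _ _ => ha, fun _ _ => hb, fun _ _ => hc', fun _ _ => hd', by simp⟩

/-! ### Small total weight -/

theorem Sat.exists_spansV_patterns4 [Fintype V] [Nonempty V] {Ω : WeightedGraph V}
    (hΩ : Sat Ω.base Ω.weight 4) (h : ∑ v, Ω.weight v ≤ 7) : ∃ p ∈ patterns4, p.SpansV Ω := by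
  have hle : Fintype.card V ≤ ∑ v, Ω.weight v := by
    rw [← card_univ, card_eq_sum_ones]
    exact sum_le_sum fun v _ => Ω.weight_pos v
  have hpos := Fintype.card_pos (α := V)
  by_cases hc : Fintype.card V ≤ 6
  · exact exists_spansV searchFrom_table4 hΩ (by omega) h (by omega) hc
  · refine exists_spansV_of_card_seven hΩ (fun v => ?_) (by omega)
    have h1 : ∑ v, Ω.weight v = ∑ v : V, 1 := by
      rw [← card_eq_sum_ones, card_univ]
      omega
    exact ((sum_eq_sum_iff_of_le fun v _ => Ω.weight_pos v).1 h1.symm v (mem_univ v)).symm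

theorem Sat.exists_spansV_patterns3 [Fintype V] {Ω : WeightedGraph V}
    (hΩ : Sat Ω.base Ω.weight 3) (h : ∑ v, Ω.weight v = 5) : ∃ p ∈ patterns3, p.SpansV Ω := by
  have hle : Fintype.card V ≤ ∑ v, Ω.weight v := by
    rw [← card_univ, card_eq_sum_ones]
    exact sum_le_sum fun v _ => Ω.weight_pos v
  exact exists_spansV searchFrom_table3 hΩ h.ge h.le (by omega) (by omega)

theorem Sat.exists_spansV_patterns2 [Fintype V] {Ω : WeightedGraph V}
    (hΩ : Sat Ω.base Ω.weight 2) (h : ∑ v, Ω.weight v = 3) : ∃ p ∈ patterns2, p.SpansV Ω := by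
  have hle : Fintype.card V ≤ ∑ v, Ω.weight v := by
    rw [← card_univ, card_eq_sum_ones]
    exact sum_le_sum fun v _ => Ω.weight_pos v
  exact exists_spansV searchFrom_table2 hΩ h.ge h.le (by omega) (by omega)

/-! ### Isomorphisms -/

theorem IsIso.trans {X : Type*} {Ω : WeightedGraph V} {Θ : WeightedGraph W} {Ξ : WeightedGraph X}
    (h1 : Ω.IsIso Θ) (h2 : Θ.IsIso Ξ) : Ω.IsIso Ξ := by
  obtain ⟨f, hf, hf'⟩ := h1
  obtain ⟨g, hg, hg'⟩ := h2
  exact ⟨g.trans f, fun a => (hf _).trans (hg a), fun a b => (hf' _ _).trans (hg' a b)⟩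

theorem IsIso.isSpannedBy {Ω : WeightedGraph V} {Θ : WeightedGraph W} (h : Ω.IsIso Θ) :
    Ω.IsSpannedBy Θ := by
  obtain ⟨f, hf, hf'⟩ := h
  exact ⟨f, hf, fun a b => (hf' a b).2⟩

theorem IsSpannedBy.isIso {Ω : WeightedGraph V} {Θ : WeightedGraph W} (h : Ω.IsSpannedBy Θ)
    (hΘ : Θ.base = ⊤) : Ω.IsIso Θ := by
  obtain ⟨f, hf, hf'⟩ := h
  refine ⟨f, hf, fun a b => ⟨fun hab => ?_, hf' a b⟩⟩
  rw [hΘ]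
  exact fun h => hab.ne (congr_arg f h)

theorem IsSpannedBy.exists_isIso {Ω : WeightedGraph V} {Θ : WeightedGraph W}
    (h : Ω.IsSpannedBy Θ) : ∃ Ξ : WeightedGraph W, Ξ.IsSpannedBy Θ ∧ Ω.IsIso Ξ := by
  obtain ⟨f, hf, hf'⟩ := h
  exact ⟨⟨Ω.base.comap f, Θ.weight, Θ.weight_pos⟩, ⟨Equiv.refl W, fun _ => rfl, hf'⟩,
    f, hf, fun _ _ => Iff.rfl⟩

theorem IsIso.disjointUnion {X : Type*} {Θ : WeightedGraph V} {Ξ : WeightedGraph W}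
    (h : Θ.IsIso Ξ) (Ω : WeightedGraph X) : (Ω.disjointUnion Θ).IsIso (Ω.disjointUnion Ξ) := by
  obtain ⟨f, hf, hf'⟩ := h
  refine ⟨Equiv.sumCongr (Equiv.refl X) f, ?_, ?_⟩
  · rintro (a | a)
    · rfl
    · exact hf a
  · rintro (a | a) (b | b)
    · exact Iff.rfl
    · exact Iff.rfl
    · exact Iff.rfl
    · exact hf' a b

theorem IsIso.sat_iff [Fintype V] [Fintype W] {Ω : WeightedGraph V} {Θ : WeightedGraph W}
    (h : Ω.IsIso Θ) (t : ℕ) : Sat Ω.base Ω.weight t ↔ Sat Θ.base Θ.weight t := by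
  obtain ⟨f, hf, hf'⟩ := h
  rw [← sat_comap f.toEmbedding fun v hv => (hv ⟨f.symm v, by simp⟩).elim]
  have h1 : Ω.base.comap f.toEmbedding = Θ.base := by
    ext a b
    exact hf' a b
  have h2 : Ω.weight ∘ f.toEmbedding = Θ.weight := funext hf
  rw [h1, h2]

theorem IsIso.sum_weight [Fintype V] [Fintype W] {Ω : WeightedGraph V} {Θ : WeightedGraph W}
    (h : Ω.IsIso Θ) : ∑ v, Ω.weight v = ∑ v, Θ.weight v := by
  obtain ⟨f, hf, -⟩ := h
  rw [← Equiv.sum_comp f]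
  exact sum_congr rfl fun a _ => hf a

/-! ### Disjoint unions with a triangle -/

theorem isTriangleComp_disjointUnion (Θ : WeightedGraph W) :
    IsTriangleComp (triangle.disjointUnion Θ).base (triangle.disjointUnion Θ).weight
      (univ.map Function.Embedding.inl) := by
  refine ⟨by simp, ?_, ?_, ?_⟩
  · simp only [mem_map, mem_univ, true_and, forall_exists_index]
    rintro _ a rfl
    rfl
  · simp only [mem_map, mem_univ, true_and, forall_exists_index]
    rintro _ a rfl _ b rfl hab
    exact fun h : a = b => hab (h ▸ rfl)
  · simp only [mem_map, mem_univ, true_and, forall_exists_index]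
    rintro _ a rfl (b | b) hb -
    · exact (hb ⟨b, rfl⟩).elim
    · simp [disjointUnion]

theorem zeroOn_disjointUnion (Θ : WeightedGraph W) :
    zeroOn (triangle.disjointUnion Θ).weight (univ.map Function.Embedding.inl) ∘
      Function.Embedding.inr = Θ.weight := by
  ext x
  simp [zeroOn, disjointUnion]

theorem zeroOn_disjointUnion_eq_zero (Θ : WeightedGraph W) (v : Fin 3 ⊕ W)
    (hv : v ∉ Set.range (Function.Embedding.inr : W ↪ Fin 3 ⊕ W)) :
    zeroOn (triangle.disjointUnion Θ).weight (univ.map Function.Embedding.inl) v = 0 := by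
  rcases v with v | v
  · simp [zeroOn]
  · exact (hv ⟨v, rfl⟩).elim

theorem comap_inr_disjointUnion (Θ : WeightedGraph W) :
    (triangle.disjointUnion Θ).base.comap (Function.Embedding.inr : W ↪ Fin 3 ⊕ W) = Θ.base := by
  ext a b
  exact Iff.rfl

theorem hasM_zeroOn_disjointUnion (Θ : WeightedGraph W) (m : ℕ) :
    HasM (triangle.disjointUnion Θ).base
      (zeroOn (triangle.disjointUnion Θ).weight (univ.map Function.Embedding.inl)) m ↔
      HasM Θ.base Θ.weight m := by
  rw [← hasM_comap Function.Embedding.inr (zeroOn_disjointUnion_eq_zero Θ),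
    comap_inr_disjointUnion, zeroOn_disjointUnion]

theorem sat_disjointUnion [Fintype W] (Θ : WeightedGraph W) (t : ℕ) :
    Sat (triangle.disjointUnion Θ).base (triangle.disjointUnion Θ).weight (t + 2) ↔
      Sat Θ.base Θ.weight (t + 1) ∧ HasM Θ.base Θ.weight t := by
  rw [(isTriangleComp_disjointUnion Θ).sat_iff, hasM_zeroOn_disjointUnion,
    ← sat_comap Function.Embedding.inr (zeroOn_disjointUnion_eq_zero Θ), comap_inr_disjointUnion,
    zeroOn_disjointUnion]

theorem sum_weight_disjointUnion [Fintype W] (Θ : WeightedGraph W) :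
    ∑ v, (triangle.disjointUnion Θ).weight v = 3 + ∑ v, Θ.weight v := by
  simp [disjointUnion, triangle, ofSimple]

theorem IsTriangleComp.isIso {Ω : WeightedGraph V} {T : Finset V}
    (hT : IsTriangleComp Ω.base Ω.weight T) :
    Ω.IsIso (triangle.disjointUnion (Ω.deleteVerts (T : Set V))) := by
  classical
  refine ⟨(Equiv.sumCongr (T.equivFinOfCardEq hT.card).symm (Equiv.refl _)).trans
    (Equiv.Set.sumCompl (T : Set V)), ?_, ?_⟩
  · rintro (a | a)
    · exact hT.weight _ (Subtype.prop _)
    · rfl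
  · rintro (a | a) (b | b)
    · set e := (T.equivFinOfCardEq hT.card).symm
      change Ω.base.Adj (e a) (e b) ↔ a ≠ b
      refine ⟨fun h hab => h.ne (by rw [hab]), fun hab => hT.adj _ (e a).2 _ (e b).2 fun h => ?_⟩
      exact hab (e.injective (Subtype.ext h))
    · exact iff_of_false (hT.not_adj _ (Subtype.prop _) _ b.2 (Ω.weight_pos _))
        (by simp [disjointUnion])
    · exact iff_of_false (fun h => hT.not_adj _ (Subtype.prop _) _ a.2 (Ω.weight_pos _) h.symm)
        (by simp [disjointUnion])
    · exact Iff.rfl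

/-- A `t`-saturating weighted graph of large total weight has a triangle as a component. -/
theorem Sat.exists_isIso_disjointUnion [Fintype V] {Ω : WeightedGraph V} {t : ℕ}
    (h : Sat Ω.base Ω.weight (t + 2)) (ht : t ≤ 2) (hn : 2 * (t + 2) ≤ ∑ v, Ω.weight v) :
    ∃ (T : Finset V) (_ : Fintype ↥((T : Set V)ᶜ)),
      Ω.IsIso (triangle.disjointUnion (Ω.deleteVerts (T : Set V))) ∧
      Sat (Ω.deleteVerts (T : Set V)).base (Ω.deleteVerts (T : Set V)).weight (t + 1) ∧
      ∑ v, Ω.weight v = 3 + ∑ v, (Ω.deleteVerts (T : Set V)).weight v := by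
  classical
  obtain ⟨T, hT⟩ := h.exists_isTriangleComp (by omega) hn
  have hiso := hT.isIso
  refine ⟨T, inferInstance, hiso, ((sat_disjointUnion _ t).1 ((hiso.sat_iff _).1 h)).1, ?_⟩
  rw [hiso.sum_weight, sum_weight_disjointUnion]

/-! ### Patterns are saturating -/

noncomputable section

/-- A test for the pattern to be `t`-saturating. -/
def Pattern.satB (p : Pattern) (t : ℕ) : Bool :=
  Nat.ble p.weights.length 8 && Nat.ble (p.weights.sum + 1) (2 * t) &&
  p.edges.all (fun e => Nat.ble (e.1 + 1) 8 && Nat.ble (e.2 + 1) 8 && !Nat.beq e.1 e.2) &&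
  force (edgesBits p.edges) fun P => allB p.weights.length fun v =>
    condB p.weights.length t 0 P (fun i => p.weights.getD i 0) v

/-- The base of a pattern. -/
def Pattern.graph (p : Pattern) : SimpleGraph (Fin p.weights.length) :=
  SimpleGraph.fromRel fun a b => (a.val, b.val) ∈ p.edges

theorem Pattern.satB_spec {p : Pattern} {t : ℕ} (h : p.satB t = true) :
    p.weights.sum < 2 * t ∧
    (∀ a b : Fin p.weights.length, bit (edgesBits p.edges) a b = true ↔ p.graph.Adj a b) ∧
    ∀ v : Fin p.weights.length,
      condB p.weights.length t 0 (edgesBits p.edges) (fun i => p.weights.getD i 0) v = true := by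
  simp only [satB, Bool.and_eq_true, List.all_eq_true, allB_eq_true, force_eq, Nat.ble_eq,
    Bool.not_eq_true'] at h
  obtain ⟨⟨⟨h1, h2⟩, h3⟩, h4⟩ := h
  refine ⟨by omega, fun a b => ?_, fun v => h4 v v.2⟩
  rw [bit_edgesBits (b.2.trans_le h1) fun e he => ⟨(h3 e he).1.1, (h3 e he).1.2⟩, graph,
    SimpleGraph.fromRel_adj]
  refine ⟨fun h => ⟨?_, h⟩, fun h => h.2⟩
  rintro rfl
  have := (h3 (a.val, a.val) (by simpa using h)).2
  rw [Nat.beq_refl] at this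
  exact Bool.noConfusion this

theorem Pattern.SpansV.graph_le {p : Pattern} {Ω : WeightedGraph V}
    {f : Fin p.weights.length ≃ V}
    (hf : ∀ a b : Fin p.weights.length, (a.val, b.val) ∈ p.edges → Ω.base.Adj (f a) (f b)) :
    p.graph ≤ Ω.base.comap f := by
  intro a b hab
  rcases ((SimpleGraph.fromRel_adj _ _ _).1 hab).2 with h | h
  · exact hf a b h
  · exact (hf b a h).symm

theorem Pattern.SpansV.sat [Fintype V] {p : Pattern} {Ω : WeightedGraph V} {t : ℕ}
    (h : p.SpansV Ω) (hp : p.satB t = true) : Sat Ω.base Ω.weight t := by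
  obtain ⟨h1, h2, h3⟩ := Pattern.satB_spec hp
  obtain ⟨f, hf, hf'⟩ := h
  have hw : Ω.weight ∘ f.toEmbedding = fun i : Fin p.weights.length => p.weights.getD i 0 := funext hf
  rw [← sat_comap f.toEmbedding fun v hv => (hv ⟨f.symm v, by simp⟩).elim, hw]
  refine ⟨fun h => ?_, fun v _ => hasM_del_mono (Pattern.SpansV.graph_le hf')
    (hasM_of_condB (w := fun i => p.weights.getD i 0) h2 (h3 v))⟩
  have h4 := h.two_mul_le
  have h5 : ∑ i : Fin p.weights.length, p.weights.getD i 0 = p.weights.sum := by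
    rw [← Fin.sum_univ_getElem p.weights]
    exact sum_congr rfl fun i _ => List.getD_eq_getElem _ _ i.2
  omega

theorem Pattern.SpansV.hasM {p : Pattern} {Ω : WeightedGraph V} {t m : ℕ}
    (h : p.SpansV Ω) (hp : p.satB t = true)
    (hm : hasMB p.weights.length (edgesBits p.edges) m (fun i => p.weights.getD i 0) = true) :
    HasM Ω.base Ω.weight m := by
  obtain ⟨-, h2, -⟩ := Pattern.satB_spec hp
  obtain ⟨f, hf, hf'⟩ := h
  have hw : Ω.weight ∘ f.toEmbedding = fun i : Fin p.weights.length => p.weights.getD i 0 := funext hf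
  rw [← hasM_comap f.toEmbedding fun v hv => (hv ⟨f.symm v, by simp⟩).elim, hw]
  exact (hasM_of_hasMB (w := fun i => p.weights.getD i 0) (fun a b => (h2 a b).1) hm).mono
    (Pattern.SpansV.graph_le hf') fun _ => le_rfl

theorem satB_patterns4 : ∀ p ∈ patterns4, p.satB 4 = true := by decide +kernel

theorem satB_patterns3 : ∀ p ∈ patterns3, p.satB 3 = true ∧
    hasMB p.weights.length (edgesBits p.edges) 2 (fun i => p.weights.getD i 0) = true := by
  decide +kernel

theorem satB_patterns2 : ∀ p ∈ patterns2, p.satB 2 = true ∧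
    hasMB p.weights.length (edgesBits p.edges) 1 (fun i => p.weights.getD i 0) = true := by
  decide +kernel

end

/-! ### The types as patterns -/

instance (n : ℕ) (L : List (Fin n × Fin n)) : DecidableRel (edges n L).Adj := fun a b =>
  decidable_of_iff (a ≠ b ∧ ((a, b) ∈ L ∨ (b, a) ∈ L)) Iff.rfl

instance : DecidableRel paw.Adj := inferInstanceAs (DecidableRel (edges _ _).Adj)

instance : DecidableRel bowtie.Adj := inferInstanceAs (DecidableRel (edges _ _).Adj)

instance (G : SimpleGraph V) [h : DecidableRel G.Adj] (w : V → ℕ) (hw : ∀ v, 0 < w v) :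
    DecidableRel (⟨G, w, hw⟩ : WeightedGraph V).base.Adj := h

instance (G : SimpleGraph V) [h : DecidableRel G.Adj] : DecidableRel (ofSimple G).base.Adj := h

instance : DecidableRel triangle.base.Adj := inferInstanceAs (DecidableRel (ofSimple ⊤).base.Adj)

instance : DecidableRel pentagon.base.Adj := inferInstanceAs (DecidableRel (ofSimple _).base.Adj)

instance (Ω : WeightedGraph V) (Θ : WeightedGraph W) [DecidableRel Ω.base.Adj]
    [DecidableRel Θ.base.Adj] : DecidableRel (Ω.disjointUnion Θ).base.Adj
  | .inl a, .inl b => inferInstanceAs (Decidable (Ω.base.Adj a b))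
  | .inr a, .inr b => inferInstanceAs (Decidable (Θ.base.Adj a b))
  | .inl _, .inr _ => .isFalse (by simp [disjointUnion])
  | .inr _, .inl _ => .isFalse (by simp [disjointUnion])

instance {k : ℕ} (p : Pattern) (Θ : WeightedGraph (Fin k)) [DecidableRel Θ.base.Adj] :
    Decidable (p.Represents Θ) :=
  inferInstanceAs (Decidable (_ ∧ _ ∧ _))

/-- A triangle and a complete graph on four vertices, connected by an edge, are spanned by two
triangles connected by a path of length two. -/
theorem exists_two_triangles_path (i : Fin 3) (j : Fin 4) : ∃ g : Fin 7 → Fin 7, g.Injective ∧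
    ∀ e ∈ [((0 : Fin 7), (1 : Fin 7)), (0, 2), (1, 2), (2, 3), (3, 4), (4, 5), (4, 6), (5, 6)],
      (g e.1 = Fin.castAdd 4 i ∧ g e.2 = Fin.natAdd 3 j) ∨ (g e.1 ≠ g e.2 ∧
        ((g e.1 < 3 ∧ g e.2 < 3) ∨ (3 ≤ g e.1 ∧ 3 ≤ g e.2))) := by
  refine ⟨![Fin.castAdd 4 (i + 1), Fin.castAdd 4 (i + 2), Fin.castAdd 4 i, Fin.natAdd 3 j,
    Fin.natAdd 3 (j + 1), Fin.natAdd 3 (j + 2), Fin.natAdd 3 (j + 3)], ?_, ?_⟩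
  · revert i j
    decide +kernel
  · revert i j
    decide +kernel

/-- The pattern of a triangle and a complete graph on four vertices. -/
theorem spansV_triangleCompleteFour {Ω : WeightedGraph V}
    (h : Ω.IsIso (triangle.disjointUnion (ofSimple (⊤ : SimpleGraph (Fin 4))))) :
    patterns4[4].SpansV Ω := by
  obtain ⟨f, hf, hf'⟩ := h
  refine ⟨(finSumFinEquiv (m := 3) (n := 4)).symm.trans f, fun i => (hf _).trans ?_,
    fun a b hab => (hf' _ _).2 ?_⟩
  · revert i
    decide
  · have h : ∀ a b : Fin 7, (a.val, b.val) ∈ patterns4[4].edges →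
        (triangle.disjointUnion (ofSimple (⊤ : SimpleGraph (Fin 4)))).base.Adj
          ((finSumFinEquiv (m := 3) (n := 4)).symm a)
          ((finSumFinEquiv (m := 3) (n := 4)).symm b) := by decide
    exact h a b hab

theorem types_of_triangleCompleteFour {Ω : WeightedGraph V} (h : patterns4[4].SpansV Ω) :
    Ω.IsSimpleType := by
  obtain ⟨f, hf, hf'⟩ := h
  change Fin 7 ≃ V at f
  have hw : ∀ x : Fin 7, Ω.weight (f x) = 1 := by
    intro x
    refine (hf x).trans ?_
    revert x
    decide
  have hK : ∀ x y : Fin 7, x ≠ y → (x < 3 ∧ y < 3) ∨ (3 ≤ x ∧ 3 ≤ y) → Ω.base.Adj (f x) (f y) := by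
    have h : ∀ x y : Fin 7, x ≠ y → (x < 3 ∧ y < 3) ∨ (3 ≤ x ∧ 3 ≤ y) →
        (x.val, y.val) ∈ patterns4[4].edges ∨ (y.val, x.val) ∈ patterns4[4].edges := by decide
    intro x y hxy hxy'
    rcases h x y hxy hxy' with h | h
    · exact hf' x y h
    · exact (hf' y x h).symm
  by_cases hx : ∃ (i : Fin 3) (j : Fin 4), Ω.base.Adj (f (Fin.castAdd 4 i)) (f (Fin.natAdd 3 j))
  · obtain ⟨i, j, hij⟩ := hx
    obtain ⟨g, hg, hg'⟩ := exists_two_triangles_path i j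
    refine .twoTrianglesPath ((Pattern.Represents.isSpannedBy_iff (p := patterns4[9]) (by decide)).2
      ⟨(Equiv.ofBijective g (Finite.injective_iff_bijective.1 hg)).trans f, fun x => ?_,
        fun a b hab => ?_⟩)
    · refine (hw (g x)).trans ?_
      revert x
      decide
    · change Ω.base.Adj (f (g a)) (f (g b))
      have h : ∀ a b : Fin 7, (a.val, b.val) ∈ patterns4[9].edges → (a, b) ∈ [((0 : Fin 7),
        (1 : Fin 7)), (0, 2), (1, 2), (2, 3), (3, 4), (4, 5), (4, 6), (5, 6)] := by decide
      rcases hg' _ (h a b hab) with ⟨h1, h2⟩ | ⟨h1, h2⟩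
      · simp only at h1 h2
        rwa [h1, h2]
      · exact hK _ _ h1 h2
  · push Not at hx
    refine .triangleCompleteFour ⟨finSumFinEquiv.trans f, ?_, ?_⟩
    · rintro (a | a)
      · exact hw _
      · exact hw _
    · rintro (a | a) (b | b)
      · change Ω.base.Adj (f (Fin.castAdd 4 a)) (f (Fin.castAdd 4 b)) ↔ a ≠ b
        refine ⟨fun h hab => h.ne (by rw [hab]), fun h => hK _ _ ?_ ?_⟩ <;> revert a b <;> decide
      · exact iff_of_false (hx a b) (by simp [disjointUnion])
      · exact iff_of_false (fun h => hx b a h.symm) (by simp [disjointUnion])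
      · change Ω.base.Adj (f (Fin.natAdd 3 a)) (f (Fin.natAdd 3 b)) ↔ a ≠ b
        refine ⟨fun h hab => h.ne (by rw [hab]), fun h => hK _ _ ?_ ?_⟩ <;> revert a b <;> decide

theorem types_of_spansV {Ω : WeightedGraph V} {p : Pattern} (hp : p ∈ patterns4)
    (h : p.SpansV Ω) : Ω.IsSimpleType ∨ Ω.IsNonsimpleType := by
  simp only [patterns4, List.mem_cons, List.not_mem_nil, or_false] at hp
  rcases hp with rfl | rfl | rfl | rfl | rfl | rfl | rfl | rfl | rfl | rfl | rfl | rfl | rfl | rfl |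
    rfl | rfl | rfl | rfl | rfl | rfl | rfl | rfl | rfl | rfl | rfl | rfl | rfl | rfl | rfl
  · exact .inl (.completeFive (((Pattern.Represents.isSpannedBy_iff (by decide)).2 h).isIso rfl))
  · exact .inl (.conePentagon ((Pattern.Represents.isSpannedBy_iff (by decide)).2 h))
  · exact .inl (.fourTriangles ((Pattern.Represents.isSpannedBy_iff (by decide)).2 h))
  · exact .inl (.prism ((Pattern.Represents.isSpannedBy_iff (by decide)).2 h))
  · exact .inl (types_of_triangleCompleteFour h)
  · exact .inl (.heptagon ((Pattern.Represents.isSpannedBy_iff (by decide)).2 h))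
  · exact .inl (.trianglePentagon ((Pattern.Represents.isSpannedBy_iff (by decide)).2 h))
  · exact .inl (.twoPentagons ((Pattern.Represents.isSpannedBy_iff (by decide)).2 h))
  · exact .inl (.threeTriangles ((Pattern.Represents.isSpannedBy_iff (by decide)).2 h))
  · exact .inl (.twoTrianglesPath ((Pattern.Represents.isSpannedBy_iff (by decide)).2 h))
  · exact .inr (.triangle222 (((Pattern.Represents.isSpannedBy_iff (by decide)).2 h).isIso rfl))
  · exact .inr (.triangle322 (((Pattern.Represents.isSpannedBy_iff (by decide)).2 h).isIso rfl))
  · exact .inr (.triangle331 (((Pattern.Represents.isSpannedBy_iff (by decide)).2 h).isIso rfl))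
  · exact .inr (.paw3211 ((Pattern.Represents.isSpannedBy_iff (by decide)).2 h))
  · exact .inr (.paw3112 ((Pattern.Represents.isSpannedBy_iff (by decide)).2 h))
  · exact .inr (.paw2221 ((Pattern.Represents.isSpannedBy_iff (by decide)).2 h))
  · exact .inr (.trianglePathTail ((Pattern.Represents.isSpannedBy_iff (by decide)).2 h))
  · exact .inr (.triangleTwoTails ((Pattern.Represents.isSpannedBy_iff (by decide)).2 h))
  · exact .inr (.triangleDoubleTail ((Pattern.Represents.isSpannedBy_iff (by decide)).2 h))
  · exact .inr (.diamond ((Pattern.Represents.isSpannedBy_iff (by decide)).2 h))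
  · exact .inr (.bowtie21111 ((Pattern.Represents.isSpannedBy_iff (by decide)).2 h))
  · exact .inr (.bowtie22111 ((Pattern.Represents.isSpannedBy_iff (by decide)).2 h))
  · exact .inr (.bowtie12211 ((Pattern.Represents.isSpannedBy_iff (by decide)).2 h))
  · exact .inr (.bowtieTailCenter ((Pattern.Represents.isSpannedBy_iff (by decide)).2 h))
  · exact .inr (.bowtieTailLeaf ((Pattern.Represents.isSpannedBy_iff (by decide)).2 h))
  · exact .inr (.twoTrianglesEdge ((Pattern.Represents.isSpannedBy_iff (by decide)).2 h))
  · exact .inr (.pentagon22111 ((Pattern.Represents.isSpannedBy_iff (by decide)).2 h))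
  · exact .inr (.pentagonTail ((Pattern.Represents.isSpannedBy_iff (by decide)).2 h))
  · exact .inr (.rectangleTriangle ((Pattern.Represents.isSpannedBy_iff (by decide)).2 h))

section

set_option maxRecDepth 100000

theorem sat_of_spansV_patterns4 [Fintype V] {Ω : WeightedGraph V} (i : Fin patterns4.length)
    (h : patterns4[i].SpansV Ω) : Sat Ω.base Ω.weight 4 :=
  h.sat (satB_patterns4 _ (List.getElem_mem _))

theorem sat_disjointUnion_of_spansV_patterns3 [Fintype V] [Fintype W] {Ω : WeightedGraph V}
    {Θ : WeightedGraph W} (i : Fin patterns3.length) (hΘ : patterns3[i].SpansV Θ)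
    (h : Ω.IsIso (triangle.disjointUnion Θ)) : Sat Ω.base Ω.weight 4 := by
  obtain ⟨h1, h2⟩ := satB_patterns3 _ (List.getElem_mem i.2)
  exact (h.sat_iff 4).2 ((sat_disjointUnion Θ 2).2 ⟨hΘ.sat h1, hΘ.hasM h1 h2⟩)

theorem represents_triangle : patterns2[0].Represents triangle := by decide

theorem IsSimpleType.sat [Fintype V] {Ω : WeightedGraph V} (h : Ω.IsSimpleType) :
    Sat Ω.base Ω.weight 4 := by
  have h4 (i : Fin patterns4.length) {k : ℕ} (Θ : WeightedGraph (Fin k))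
      (hi : patterns4[i].Represents Θ) (h : Ω.IsSpannedBy Θ) : Sat Ω.base Ω.weight 4 :=
    sat_of_spansV_patterns4 i (hi.isSpannedBy_iff.1 h)
  cases h with
  | completeFive h => exact h4 ⟨0, by decide⟩ _ (by decide) h.isSpannedBy
  | conePentagon h => exact h4 ⟨1, by decide⟩ _ (by decide) h
  | fourTriangles h => exact h4 ⟨2, by decide⟩ _ (by decide) h
  | prism h => exact h4 ⟨3, by decide⟩ _ (by decide) h
  | trianglePentagonDisjoint Θ hΘ h =>
    exact sat_disjointUnion_of_spansV_patterns3 ⟨0, by decide⟩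
      ((Pattern.Represents.isSpannedBy_iff (by decide)).1 hΘ) h
  | triangleBowtieDisjoint Θ hΘ h =>
    exact sat_disjointUnion_of_spansV_patterns3 ⟨1, by decide⟩
      ((Pattern.Represents.isSpannedBy_iff (by decide)).1 hΘ) h
  | triangleCompleteFour h =>
    exact sat_of_spansV_patterns4 ⟨4, by decide⟩ (spansV_triangleCompleteFour h)
  | heptagon h => exact h4 ⟨5, by decide⟩ _ (by decide) h
  | trianglePentagon h => exact h4 ⟨6, by decide⟩ _ (by decide) h
  | twoPentagons h => exact h4 ⟨7, by decide⟩ _ (by decide) h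
  | threeTriangles h => exact h4 ⟨8, by decide⟩ _ (by decide) h
  | twoTrianglesPath h => exact h4 ⟨9, by decide⟩ _ (by decide) h
  | threeTrianglesDisjoint h =>
    have h3 : patterns2[0].SpansV triangle := represents_triangle.isSpannedBy_iff.1
      ⟨Equiv.refl _, fun _ => rfl, fun _ _ => id⟩
    obtain ⟨h1, h2⟩ := satB_patterns2 patterns2[0] (List.getElem_mem _)
    refine (h.sat_iff 4).2 ((sat_disjointUnion _ 2).2 ⟨(sat_disjointUnion _ 1).2
      ⟨h3.sat h1, h3.hasM h1 h2⟩, ?_⟩)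
    refine (isTriangleComp_disjointUnion triangle).hasM_succ ?_
    exact (hasM_zeroOn_disjointUnion _ 1).2 (h3.hasM h1 h2)

theorem IsNonsimpleType.sat [Fintype V] {Ω : WeightedGraph V} (h : Ω.IsNonsimpleType) :
    Sat Ω.base Ω.weight 4 := by
  have h4 (i : Fin patterns4.length) {k : ℕ} (Θ : WeightedGraph (Fin k))
      (hi : patterns4[i].Represents Θ) (h : Ω.IsSpannedBy Θ) : Sat Ω.base Ω.weight 4 :=
    sat_of_spansV_patterns4 i (hi.isSpannedBy_iff.1 h)
  cases h with
  | triangle222 h => exact h4 ⟨10, by decide⟩ _ (by decide) h.isSpannedBy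
  | triangle322 h => exact h4 ⟨11, by decide⟩ _ (by decide) h.isSpannedBy
  | triangle331 h => exact h4 ⟨12, by decide⟩ _ (by decide) h.isSpannedBy
  | paw3211 h => exact h4 ⟨13, by decide⟩ _ (by decide) h
  | paw3112 h => exact h4 ⟨14, by decide⟩ _ (by decide) h
  | paw2221 h => exact h4 ⟨15, by decide⟩ _ (by decide) h
  | trianglePathTail h => exact h4 ⟨16, by decide⟩ _ (by decide) h
  | triangleTwoTails h => exact h4 ⟨17, by decide⟩ _ (by decide) h
  | triangleDoubleTail h => exact h4 ⟨18, by decide⟩ _ (by decide) h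
  | diamond h => exact h4 ⟨19, by decide⟩ _ (by decide) h
  | bowtie21111 h => exact h4 ⟨20, by decide⟩ _ (by decide) h
  | bowtie22111 h => exact h4 ⟨21, by decide⟩ _ (by decide) h
  | bowtie12211 h => exact h4 ⟨22, by decide⟩ _ (by decide) h
  | bowtieTailCenter h => exact h4 ⟨23, by decide⟩ _ (by decide) h
  | bowtieTailLeaf h => exact h4 ⟨24, by decide⟩ _ (by decide) h
  | twoTrianglesEdge h => exact h4 ⟨25, by decide⟩ _ (by decide) h
  | pentagon22111 h => exact h4 ⟨26, by decide⟩ _ (by decide) h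
  | pentagonTail h => exact h4 ⟨27, by decide⟩ _ (by decide) h
  | rectangleTriangle h => exact h4 ⟨28, by decide⟩ _ (by decide) h
  | triangleTriangle221 h =>
    exact sat_disjointUnion_of_spansV_patterns3 ⟨2, by decide⟩
      ((Pattern.Represents.isSpannedBy_iff
        (Θ := ⟨(⊤ : SimpleGraph (Fin 3)), ![2, 2, 1], by decide⟩) (by decide)).1
          ⟨Equiv.refl _, fun _ => rfl, fun _ _ => id⟩) h
  | trianglePaw Θ hΘ h =>
    exact sat_disjointUnion_of_spansV_patterns3 ⟨3, by decide⟩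
      ((Pattern.Represents.isSpannedBy_iff (by decide)).1 hΘ) h

end

/-! ### The classification -/

theorem Sat.types_of_sum_eq_eight [Fintype V] {Ω : WeightedGraph V} (h : Sat Ω.base Ω.weight 4)
    (hn : ∑ v, Ω.weight v = 8) : Ω.IsSimpleType ∨ Ω.IsNonsimpleType := by
  obtain ⟨T, _, hT, hsat, hsum⟩ := h.exists_isIso_disjointUnion (t := 2) le_rfl hn.ge
  obtain ⟨p, hp, h⟩ := hsat.exists_spansV_patterns3 (by omega)
  simp only [patterns3, List.mem_cons, List.not_mem_nil, or_false] at hp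
  rcases hp with rfl | rfl | rfl | rfl
  · obtain ⟨Ξ, h1, h2⟩ := IsSpannedBy.exists_isIso
      ((Pattern.Represents.isSpannedBy_iff (Θ := pentagon) (by decide)).2 h)
    exact .inl (.trianglePentagonDisjoint Ξ h1 (hT.trans (h2.disjointUnion _)))
  · obtain ⟨Ξ, h1, h2⟩ := IsSpannedBy.exists_isIso
      ((Pattern.Represents.isSpannedBy_iff (Θ := ofSimple bowtie) (by decide)).2 h)
    exact .inl (.triangleBowtieDisjoint Ξ h1 (hT.trans (h2.disjointUnion _)))
  · exact .inr (.triangleTriangle221 (hT.trans (IsIso.disjointUnion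
      (((Pattern.Represents.isSpannedBy_iff (by decide)).2 h).isIso rfl) _)))
  · obtain ⟨Ξ, h1, h2⟩ := IsSpannedBy.exists_isIso
      ((Pattern.Represents.isSpannedBy_iff (Θ := ⟨paw, ![2, 1, 1, 1], by decide⟩) (by decide)).2 h)
    exact .inr (.trianglePaw Ξ h1 (hT.trans (h2.disjointUnion _)))

theorem Sat.types_of_sum_eq_nine [Fintype V] {Ω : WeightedGraph V} (h : Sat Ω.base Ω.weight 4)
    (hn : ∑ v, Ω.weight v = 9) : Ω.IsSimpleType ∨ Ω.IsNonsimpleType := by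
  obtain ⟨T, _, hT, hsat, hsum⟩ := h.exists_isIso_disjointUnion (t := 2) le_rfl (by omega)
  obtain ⟨T', _, hT', hsat', hsum'⟩ :=
    hsat.exists_isIso_disjointUnion (t := 1) one_le_two (by omega)
  obtain ⟨p, hp, h⟩ := hsat'.exists_spansV_patterns2 (by omega)
  simp only [patterns2, List.mem_cons, List.not_mem_nil, or_false] at hp
  subst hp
  have h3 := (represents_triangle.isSpannedBy_iff.2 h).isIso rfl
  exact .inl (.threeTrianglesDisjoint
    (hT.trans ((hT'.trans (h3.disjointUnion _)).disjointUnion _)))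

end WeightedGraph

open WeightedGraph in
theorem mainTheorem2 {V : Type*} [Fintype V] [Nonempty V] (Ω : WeightedGraph V) :
    Ω.IsSaturating 4 ↔ Ω.IsSimpleType ∨ Ω.IsNonsimpleType := by
  rw [isSaturating_iff_sat]
  refine ⟨fun h => ?_, fun h => h.elim (·.sat) (·.sat)⟩
  have hn := h.sum_le
  rcases le_or_gt (∑ v, Ω.weight v) 7 with h7 | h7
  · obtain ⟨p, hp, hp'⟩ := h.exists_spansV_patterns4 h7
    exact types_of_spansV hp hp'
  · rcases (show ∑ v, Ω.weight v = 8 ∨ ∑ v, Ω.weight v = 9 by omega) with h8 | h9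
    · exact h.types_of_sum_eq_eight h8
    · exact h.types_of_sum_eq_nine h9
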